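/- Let $\mathbb{R}^3_1$ be $\mathbb{R}^3$ with the Lorentzian product $\langle u,v\rangle=u_1v_1+u_2v_2-u_3v_3$, let $\mathbb{H}^2=\{u:\langle u,u\rangle=-1,\ u_3>0\}$, let $\mathbb{S}^2_1=\{u:\langle u,u\rangle=1\}$, and let $\mathbb{H}^2\times\mathbb{R}\subset\mathbb{R}^3_1\times\mathbb{R}$ carry the Riemannian product metric $\widetilde g=\langle\cdot,\cdot\rangle+dt^2$. Let $(M,g)$ be a smooth Riemannian surface, $F:M\to\mathbb{H}^2\times\mathbb{R}$ a smooth isometric immersion and $\xi$ a smooth unit normal field of $M$ in $\mathbb{H}^2\times\mathbb{R}$. Write $\partial_t=F_*T+\cos\theta\,\xi$, where $T$ is the tangential part of $\partial_t$ and $\theta:M\to[0,\pi]$ is the angle function. Assume that $\theta$ never takes the values $0,\frac{\pi}{2},\pi$. (1) $T$ is a principal direction at every point (that is, $T$ is an eigenvector of the shape operator of $\xi$, possibly with eigenvalue $0$) if and only if around every point of $M$ there are smooth local coordinates $(x,y)$, ranging over a product $I\times J$ of nonempty open intervals, in which $F$ is given, up to an isometry of $\mathbb{H}^2\times\mathbb{R}$,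 by $$F(x,y)=\bigl(A(y)\sinh\phi(x)+B(y)\cosh\phi(x),\ \chi(x)\bigr),\qquad(\ast)$$ where $A:J\to\mathbb{S}^2_1$ and $B:J\to\mathbb{H}^2$ are smooth curves with $\langle A,B\rangle=0$ and $A'\parallel B'$ (that is, $A'(y)$ and $B'(y)$ are linearly dependent for every $y$), and $(\phi,\chi):I\to\mathbb{R}^2$ is a smooth regular curve. (2) In every such local representation there are constant signs $\varepsilon,\delta\in\{1,-1\}$ such that $\theta$ depends only on $x$, is smooth in $x$, and is the angle function of the curve $(\varepsilon\phi,\delta\chi)$, i.e. $(\varepsilon\phi',\delta\chi')=\sqrt{\phi'^2+\chi'^2}\,(\cos\theta,\sin\theta)$. The curve $(\phi,\chi)$ can be reparametrized by arc length by an increasing smooth change of the coordinate $x$ which has nowhere vanishing derivative, and this gives again a representation of the form $(\ast)$. Whenever $(\phi,\chi)$ is parametrized by arc length, $(x,y)$ are canonical coordinates, i.e. $\partial_x$ is collinear with $T$ and $g=dx^2+\beta(x,y)^2dy^2$ with $\beta>0$ smooth, and $\theta'(x)$ is the signed curvature of $(\varepsilon\phi,\delta\chi)$ at $x$. (3) If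 $T$ is a principal direction at every point, then around every point there is a representation $(\ast)$ with $(\phi,\chi)$ parametrized by arc length and $\varepsilon=\delta=1$: in it $\theta$ depends only on $x$ and is smooth, $\phi'=\cos\theta$, $\chi'=\sin\theta$, the coordinates $(x,y)$ are canonical, and $\theta'(x)=\kappa(x)$, the signed curvature of $(\phi,\chi)$. -/

import Mathlib

open scoped Manifold ContDiff

namespace H2R

noncomputable section

/-! ### The ambient space `ℍ² × ℝ` inside `ℝ³₁ × ℝ` -/

/-- The Lorentzian product `x₁y₁ + x₂y₂ - x₃y₃` on `ℝ³₁`. -/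
def lorentz (u v : Fin 3 → ℝ) : ℝ := u 0 * v 0 + u 1 * v 1 - u 2 * v 2

/-- The vector space underlying `ℝ³₁ × ℝ`. -/
abbrev Amb : Type := (Fin 3 → ℝ) × ℝ

/-- The metric `dx₁² + dx₂² - dx₃² + dt²` on `ℝ³₁ × ℝ`; on vectors tangent to `ℍ² × ℝ` it is the
Riemannian product metric of `ℍ² × ℝ`. -/
def ambMetric (V W : Amb) : ℝ := lorentz V.1 W.1 + V.2 * W.2

/-- The hyperbolic plane: upper sheet of the hyperboloid. -/
def hypPlane : Set (Fin 3 → ℝ) := {u | lorentz u u = -1 ∧ 0 < u 2}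

/-- The de Sitter space `𝕊²₁`. -/
def deSitter : Set (Fin 3 → ℝ) := {u | lorentz u u = 1}

/-- The product `ℍ² × ℝ`, as a subset of `ℝ³₁ × ℝ`. -/
def HypProd : Set Amb := {P | P.1 ∈ hypPlane}

/-- The Riemannian distance of the product `ℍ² × ℝ`: the hyperbolic distance satisfies
`cosh d(p, q) = -⟨p, q⟩`. -/
def ambDist (P Q : HypProd) : ℝ :=
  Real.sqrt (Real.arcosh (-lorentz P.1.1 Q.1.1) ^ 2 + (P.1.2 - Q.1.2) ^ 2)

/-- Isometries of the ambient space `ℍ² × ℝ`. -/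
structure AmbIsometry where
  toEquiv : HypProd ≃ HypProd
  dist_eq : ∀ P Q : HypProd, ambDist (toEquiv P) (toEquiv Q) = ambDist P Q

/-- The vector field `∂_t`. -/
def dt : Amb := (0, 1)

/-! ### Surfaces in `ℍ² × ℝ` -/

section Surface

variable {M : Type*} [TopologicalSpace M] [ChartedSpace (EuclideanSpace ℝ (Fin 2)) M]

/-- A smooth Riemannian metric on the surface `M`. -/
abbrev SurfaceMetric (M : Type*) [TopologicalSpace M] [ChartedSpace (EuclideanSpace ℝ (Fin 2)) M]
    [IsManifold (𝓡 2) ∞ M] :=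
  Bundle.ContMDiffRiemannianMetric (𝓡 2) ∞ (EuclideanSpace ℝ (Fin 2))
    (fun p : M => TangentSpace (𝓡 2) p)

/-- Derivative `D_v V` at `p` of an `ℝ³₁ × ℝ`-valued map `V` on the surface. -/
def vecDeriv (V : M → Amb) (p : M) (v : TangentSpace (𝓡 2) p) : Amb :=
  mfderiv (𝓡 2) 𝓘(ℝ, Amb) V p v

/-- The differential `dF_p v` of a map into `ℍ² × ℝ`. -/
def push (F : M → HypProd) (p : M) (v : TangentSpace (𝓡 2) p) : Amb :=
  vecDeriv (fun q => (F q : Amb)) p v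

/-- The Levi-Civita connection of `ℍ² × ℝ` along `F`: the projection of `D_v V` to the tangent
space of `ℍ² × ℝ`, whose normal in `ℝ³₁ × ℝ` is `(F₁, F₂, F₃, 0)`, of square `-1`. -/
def ambConn (F : M → HypProd) (V : M → Amb) (p : M) (v : TangentSpace (𝓡 2) p) : Amb :=
  vecDeriv V p v + lorentz (vecDeriv V p v).1 (F p).1.1 • ((F p).1.1, 0)

/-- A smooth unit normal field of the surface in `ℍ² × ℝ`. -/
structure IsUnitNormal (F : M → HypProd) (ξ : M → Amb) : Prop where
  smooth : ContMDiff (𝓡 2) 𝓘(ℝ, Amb) ∞ ξ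
  tangent : ∀ p, lorentz (F p).1.1 (ξ p).1 = 0
  unit : ∀ p, ambMetric (ξ p) (ξ p) = 1
  normal : ∀ p (v : TangentSpace (𝓡 2) p), ambMetric (ξ p) (push F p v) = 0

/-- The angle function `θ ∈ [0, π]`, that is `cos θ = g̃(ξ, ∂_t)`. -/
def angle (ξ : M → Amb) (p : M) : ℝ := Real.arccos (ambMetric (ξ p) dt)

variable [IsManifold (𝓡 2) ∞ M]

/-- `F : (M, g) → ℍ² × ℝ` is a smooth isometric immersion. -/
structure IsIsometricImmersion (g : SurfaceMetric M) (F : M → HypProd) : Prop where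
  smooth : ContMDiff (𝓡 2) 𝓘(ℝ, Amb) ∞ (fun p => (F p : Amb))
  isometric : ∀ p (v w : TangentSpace (𝓡 2) p),
    g.inner p v w = ambMetric (push F p v) (push F p w)

theorem ambMetric_add_right (U V W : Amb) :
    ambMetric U (V + W) = ambMetric U V + ambMetric U W := by
  simp only [ambMetric, lorentz, Prod.fst_add, Prod.snd_add, Pi.add_apply]; ring

theorem ambMetric_smul_right (c : ℝ) (U V : Amb) :
    ambMetric U (c • V) = c * ambMetric U V := by
  simp only [ambMetric, lorentz, Prod.smul_fst, Prod.smul_snd, Pi.smul_apply, smul_eq_mul]; ring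

theorem exists_tangentPart (g : SurfaceMetric M) (F : M → HypProd) (V : Amb) (p : M) :
    ∃ v : TangentSpace (𝓡 2) p, ∀ w : TangentSpace (𝓡 2) p,
      g.inner p v w = ambMetric V (push F p w) := by
  have : FiniteDimensional ℝ (TangentSpace (𝓡 2) p) :=
    inferInstanceAs (FiniteDimensional ℝ (EuclideanSpace ℝ (Fin 2)))
  let l : TangentSpace (𝓡 2) p →ₗ[ℝ] ℝ :=
    { toFun := fun w => ambMetric V (push F p w)
      map_add' := fun a b => by
        have h : push F p (a + b) = push F p a + push F p b := map_add (mfderiv _ _ _ p) a b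
        rw [h, ambMetric_add_right]
      map_smul' := fun c a => by
        have h : push F p (c • a) = c • push F p a := map_smul (mfderiv _ _ _ p) c a
        rw [h, ambMetric_smul_right]; rfl }
  let f : TangentSpace (𝓡 2) p →ₗ[ℝ] (TangentSpace (𝓡 2) p →ₗ[ℝ] ℝ) :=
    { toFun := fun v =>
        { toFun := fun w => g.inner p v w
          map_add' := fun a b => map_add _ a b
          map_smul' := fun c a => map_smul _ c a }
      map_add' := fun a b => by
        apply LinearMap.ext; intro w
        change g.inner p (a + b) w = g.inner p a w + g.inner p b w
        rw [map_add]; rfl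
      map_smul' := fun c a => by
        apply LinearMap.ext; intro w
        change g.inner p (c • a) w = c • g.inner p a w
        rw [map_smul]; rfl }
  have hf : Function.Injective f := by
    rw [← LinearMap.ker_eq_bot, LinearMap.ker_eq_bot']
    intro v hv
    by_contra hne
    have h1 := g.pos p v hne
    have h2 : f v v = 0 := by rw [hv]; rfl
    exact h1.ne' h2
  have hs : Function.Surjective f :=
    (LinearMap.injective_iff_surjective_of_finrank_eq_finrank
      (Subspace.dual_finrank_eq (K := ℝ) (V := TangentSpace (𝓡 2) p)).symm).1 hf
  obtain ⟨v, hv⟩ := hs l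
  exact ⟨v, fun w => LinearMap.congr_fun hv w⟩

/-- The tangential part `V^⊤ ∈ T_pM` of an ambient vector `V` at `F p`: the unique `v ∈ T_pM` with
`g(v, w) = g̃(V, dF w)` for all `w ∈ T_pM`. -/
def tangentPart (g : SurfaceMetric M) (F : M → HypProd) (V : Amb) (p : M) :
    TangentSpace (𝓡 2) p :=
  (exists_tangentPart g F V p).choose

/-- The projection `T` of `∂_t` onto the tangent planes of the surface. -/
def fieldT (g : SurfaceMetric M) (F : M → HypProd) (p : M) : TangentSpace (𝓡 2) p :=
  tangentPart g F dt p

/-- The shape operator `v ↦ -(∇̃_v ξ)^⊤`. -/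
def shapeOperator (g : SurfaceMetric M) (F : M → HypProd) (ξ : M → Amb) (p : M)
    (v : TangentSpace (𝓡 2) p) : TangentSpace (𝓡 2) p :=
  -tangentPart g F (ambConn F ξ p v) p

/-- `v` is a principal direction at `p`: an eigenvector of the shape operator. -/
def IsPrincipalDirection (g : SurfaceMetric M) (F : M → HypProd) (ξ : M → Amb) (p : M)
    (v : TangentSpace (𝓡 2) p) : Prop :=
  v ≠ 0 ∧ ∃ k : ℝ, shapeOperator g F ξ p v = k • v

/-! ### Local coordinates and the explicit form -/

/-- The coordinate field `∂_x` of a local parametrization `ψ` of `M`. -/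
def coordX (ψ : OpenPartialHomeomorph (ℝ × ℝ) M) (z : ℝ × ℝ) : TangentSpace (𝓡 2) (ψ z) :=
  mfderiv 𝓘(ℝ, ℝ × ℝ) (𝓡 2) ψ z ((1, 0) : ℝ × ℝ)

/-- The coordinate field `∂_y` of a local parametrization `ψ` of `M`. -/
def coordY (ψ : OpenPartialHomeomorph (ℝ × ℝ) M) (z : ℝ × ℝ) : TangentSpace (𝓡 2) (ψ z) :=
  mfderiv 𝓘(ℝ, ℝ × ℝ) (𝓡 2) ψ z ((0, 1) : ℝ × ℝ)

/-- `ψ` is a smooth local coordinate system `(x, y) ↦ ψ (x, y)` of `M`, with `(x, y)` ranging over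
the product `I × J` of two nonempty open intervals. -/
structure IsCoordRect (I J : Set ℝ) (ψ : OpenPartialHomeomorph (ℝ × ℝ) M) : Prop where
  openI : IsOpen I
  nonemptyI : I.Nonempty
  intervalI : I.OrdConnected
  openJ : IsOpen J
  nonemptyJ : J.Nonempty
  intervalJ : J.OrdConnected
  source_eq : ψ.source = I ×ˢ J
  smooth : ContMDiffOn 𝓘(ℝ, ℝ × ℝ) (𝓡 2) ∞ ψ ψ.source
  smooth_symm : ContMDiffOn (𝓡 2) 𝓘(ℝ, ℝ × ℝ) ∞ ψ.symm ψ.target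

/-- Canonical coordinates: `∂_x` is collinear with `T` and `g = dx² + β(x, y)² dy²`. -/
def IsCanonical (g : SurfaceMetric M) (F : M → HypProd)
    (ψ : OpenPartialHomeomorph (ℝ × ℝ) M) : Prop :=
  ∃ β : ℝ × ℝ → ℝ, ContDiffOn ℝ ∞ β ψ.source ∧ ∀ z ∈ ψ.source,
    0 < β z ∧
    (∃ c : ℝ, fieldT g F (ψ z) = c • coordX ψ z) ∧
    g.inner (ψ z) (coordX ψ z) (coordX ψ z) = 1 ∧
    g.inner (ψ z) (coordX ψ z) (coordY ψ z) = 0 ∧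
    g.inner (ψ z) (coordY ψ z) (coordY ψ z) = β z ^ 2

/-- In the coordinates `ψ` on `I × J`, and after the ambient isometry `Φ`, the immersion is
`F(x, y) = (A(y) sinh φ(x) + B(y) cosh φ(x), χ(x))`, where `A` is a curve in `𝕊²₁`, `B` is a curve
in `ℍ²`, `⟨A, B⟩ = 0`, `A'` and `B'` are parallel, and `(φ, χ)` is a regular plane curve. -/
structure IsLocalForm (F : M → HypProd) (Φ : AmbIsometry) (I J : Set ℝ)
    (ψ : OpenPartialHomeomorph (ℝ × ℝ) M) (A B : ℝ → Fin 3 → ℝ) (φ χ : ℝ → ℝ) : Prop where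
  coord : IsCoordRect I J ψ
  smoothA : ContDiffOn ℝ ∞ A J
  smoothB : ContDiffOn ℝ ∞ B J
  smoothφ : ContDiffOn ℝ ∞ φ I
  smoothχ : ContDiffOn ℝ ∞ χ I
  memA : ∀ y ∈ J, A y ∈ deSitter
  memB : ∀ y ∈ J, B y ∈ hypPlane
  orth : ∀ y ∈ J, lorentz (A y) (B y) = 0
  parallel : ∀ y ∈ J, ∃ a b : ℝ, (a, b) ≠ (0, 0) ∧ a • deriv A y + b • deriv B y = 0
  regular : ∀ x ∈ I, (deriv φ x, deriv χ x) ≠ (0, 0)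
  form : ∀ x ∈ I, ∀ y ∈ J, (Φ.toEquiv (F (ψ (x, y))) : Amb) =
    (Real.sinh (φ x) • A y + Real.cosh (φ x) • B y, χ x)

end Surface

/-! ### Plane curves -/

/-- Speed of the plane curve `(φ, χ)`. -/
def speed (φ χ : ℝ → ℝ) (x : ℝ) : ℝ := Real.sqrt (deriv φ x ^ 2 + deriv χ x ^ 2)

/-- `(φ, χ)` is parametrized by arc length on `I`. -/
def IsUnitSpeed (φ χ : ℝ → ℝ) (I : Set ℝ) : Prop := ∀ x ∈ I, speed φ χ x = 1

/-- `ϑ` is the angle function of the plane curve `(φ, χ)` on `I`: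
its unit tangent is `(cos ϑ, sin ϑ)`. -/
def IsCurveAngle (φ χ ϑ : ℝ → ℝ) (I : Set ℝ) : Prop :=
  ContDiffOn ℝ ∞ ϑ I ∧ ∀ x ∈ I,
    deriv φ x = speed φ χ x * Real.cos (ϑ x) ∧ deriv χ x = speed φ χ x * Real.sin (ϑ x)

/-- Signed curvature of the plane curve `(φ, χ)`. -/
def curvature (φ χ : ℝ → ℝ) (x : ℝ) : ℝ :=
  (deriv φ x * deriv (deriv χ) x - deriv χ x * deriv (deriv φ) x) / speed φ χ x ^ 3

end

end H2R

open H2R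

/-!
The proof rests on three observations.

*The condition in terms of the height.* Let `h` be the height function of the surface. `T` is the
gradient of `h`, `|T|² = 1 - cos² θ`, and `d(cos θ)(v) = -g(S T, v)` for the shape operator `S`,
which is self-adjoint because second derivatives commute. So `T` is principal if and only if
`d(cos θ)` vanishes wherever `dh` does (`IsPrincipalAt.fderiv_normal_snd_eq_zero`,
`IsLocalSurface.exists_isPrincipalAt`).

*From the principal direction to the explicit form* (`IsLocalSurface.exists_form`). If `T` is
principal, then `cos θ` is locally a smooth function of `h`. Let `φ` be an antiderivative of `cot θ`
as a function of `h`. Write `p` for the `ℍ²` component of the immersion and `q` for the horizontal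
unit vector opposite to the normal. Along `T` the pair `(p, q)` undergoes a hyperbolic rotation with
the speed of `φ`, so the rotated frame `A = cosh φ • q - sinh φ • p`, `B = cosh φ • p - sinh φ • q`
is constant along `T`. It is not constant in the orthogonal direction because the map is
an immersion. Hence `h` and some component `y` of `(A, B)` are coordinates, `A` and `B` depend on
`y` only, and `p = sinh φ • A + cosh φ • B`. No flow of a vector field is needed, only the inverse
function theorem.

*From the explicit form to the geometry.* Isometries of `ℍ² × ℝ` are given metrically. Two points
lie on one vertical line exactly when the parallelogram identity holds for the segment joining them
(`fst_eq_iff_exists_midpoint`), so an isometry preserves Lorentzian products of `ℍ²` components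
and acts on heights by `t ↦ ± t + c` (`AmbIsometry.lorentz_eq`, `AmbIsometry.exists_snd_eq`).
Differentiating the Lorentzian products in both arguments shows that the explicit form has the same
first fundamental form as the immersion and the same height derivative up to sign
(`IsLocalForm.gram`). Therefore `∂_x` is a multiple of `T` and `cos² θ = φ'² / (φ'² + χ'²)`; since
`θ` avoids `0`, `π / 2` and `π`, neither `φ'` nor `χ'` vanishes, and connectedness makes the signs
constant.
-/

namespace H2R

/-! ### Lorentzian algebra and the hyperbolic plane -/

theorem lorentz_comm (u v : Fin 3 → ℝ) : lorentz u v = lorentz v u := by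
  simp only [lorentz]; ring

theorem lorentz_add_left (u v w : Fin 3 → ℝ) :
    lorentz (u + v) w = lorentz u w + lorentz v w := by
  simp only [lorentz, Pi.add_apply]; ring

theorem lorentz_add_right (u v w : Fin 3 → ℝ) :
    lorentz u (v + w) = lorentz u v + lorentz u w := by
  simp only [lorentz, Pi.add_apply]; ring

theorem lorentz_sub_left (u v w : Fin 3 → ℝ) :
    lorentz (u - v) w = lorentz u w - lorentz v w := by
  simp only [lorentz, Pi.sub_apply]; ring

theorem lorentz_sub_right (u v w : Fin 3 → ℝ) :
    lorentz u (v - w) = lorentz u v - lorentz u w := by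
  simp only [lorentz, Pi.sub_apply]; ring

theorem lorentz_smul_left (c : ℝ) (u v : Fin 3 → ℝ) :
    lorentz (c • u) v = c * lorentz u v := by
  simp only [lorentz, Pi.smul_apply, smul_eq_mul]; ring

theorem lorentz_smul_right (c : ℝ) (u v : Fin 3 → ℝ) :
    lorentz u (c • v) = c * lorentz u v := by
  simp only [lorentz, Pi.smul_apply, smul_eq_mul]; ring

theorem lorentz_neg_left (u v : Fin 3 → ℝ) : lorentz (-u) v = -lorentz u v := by
  simp only [lorentz, Pi.neg_apply]; ring

theorem lorentz_neg_right (u v : Fin 3 → ℝ) : lorentz u (-v) = -lorentz u v := by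
  simp only [lorentz, Pi.neg_apply]; ring

theorem ambMetric_comm (V W : Amb) : ambMetric V W = ambMetric W V := by
  simp only [ambMetric, lorentz]; ring

theorem ambMetric_add_left (U V W : Amb) :
    ambMetric (U + V) W = ambMetric U W + ambMetric V W := by
  rw [ambMetric_comm, ambMetric_add_right, ambMetric_comm W, ambMetric_comm W]

theorem ambMetric_smul_left (c : ℝ) (U V : Amb) : ambMetric (c • U) V = c * ambMetric U V := by
  rw [ambMetric_comm, ambMetric_smul_right, ambMetric_comm V]

theorem ambMetric_dt (V : Amb) : ambMetric V dt = V.2 := by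
  simp [ambMetric, lorentz, dt]

/-- The orthogonal complement of a point of `ℍ²` is spacelike, quantitatively. -/
theorem sq_add_sq_le_of_orthogonal {w p : Fin 3 → ℝ} (hp : p ∈ hypPlane) (h : lorentz w p = 0) :
    w 0 ^ 2 + w 1 ^ 2 ≤ lorentz w w * p 2 ^ 2 := by
  obtain ⟨h1, h2⟩ := hp
  simp only [lorentz] at *
  have h3 : (w 0 * p 0 + w 1 * p 1) ^ 2 ≤ (w 0 ^ 2 + w 1 ^ 2) * (p 0 ^ 2 + p 1 ^ 2) := by
    nlinarith [sq_nonneg (w 0 * p 1 - w 1 * p 0)]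
  have h4 : w 0 * p 0 + w 1 * p 1 = w 2 * p 2 := by linarith
  have h5 : p 0 ^ 2 + p 1 ^ 2 = p 2 ^ 2 - 1 := by linarith
  rw [h4, h5] at h3
  nlinarith

theorem lorentz_self_nonneg_of_orthogonal {w p : Fin 3 → ℝ} (hp : p ∈ hypPlane)
    (h : lorentz w p = 0) : 0 ≤ lorentz w w := by
  have h1 := sq_add_sq_le_of_orthogonal hp h
  have h2 : 0 < p 2 ^ 2 := pow_pos hp.2 2
  by_contra h3
  push Not at h3
  nlinarith [sq_nonneg (w 0), sq_nonneg (w 1), mul_neg_of_neg_of_pos h3 h2]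

theorem eq_zero_of_orthogonal {w p : Fin 3 → ℝ} (hp : p ∈ hypPlane)
    (h : lorentz w p = 0) (h0 : lorentz w w = 0) : w = 0 := by
  have h1 := sq_add_sq_le_of_orthogonal hp h
  rw [h0, zero_mul] at h1
  have h2 : w 0 = 0 := by nlinarith [sq_nonneg (w 0), sq_nonneg (w 1)]
  have h3 : w 1 = 0 := by nlinarith [sq_nonneg (w 0), sq_nonneg (w 1)]
  have h4 : w 2 = 0 := by
    simp only [lorentz, h2, h3] at h0
    nlinarith
  funext i
  fin_cases i <;> simp [h2, h3, h4]

/-- The reverse Cauchy–Schwarz inequality. -/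
theorem one_le_neg_lorentz {p q : Fin 3 → ℝ} (hp : p ∈ hypPlane) (hq : q ∈ hypPlane) :
    1 ≤ -lorentz p q := by
  obtain ⟨h1, h2⟩ := hp
  obtain ⟨h3, h4⟩ := hq
  simp only [lorentz] at *
  have h5 : (p 0 * q 0 + p 1 * q 1) ^ 2 ≤ (p 0 ^ 2 + p 1 ^ 2) * (q 0 ^ 2 + q 1 ^ 2) := by
    nlinarith [sq_nonneg (p 0 * q 1 - p 1 * q 0)]
  have h6 : p 0 ^ 2 + p 1 ^ 2 = p 2 ^ 2 - 1 := by linarith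
  have h7 : q 0 ^ 2 + q 1 ^ 2 = q 2 ^ 2 - 1 := by linarith
  rw [h6, h7] at h5
  have h8 : 1 ≤ p 2 := by nlinarith [sq_nonneg (p 0), sq_nonneg (p 1)]
  have h9 : 1 ≤ q 2 := by nlinarith [sq_nonneg (q 0), sq_nonneg (q 1)]
  have h10 : (p 0 * q 0 + p 1 * q 1) ^ 2 ≤ (p 2 * q 2 - 1) ^ 2 := by
    nlinarith [sq_nonneg (p 2 - q 2)]
  have h11 := abs_le_of_sq_le_sq h10 (by nlinarith)
  linarith [le_abs_self (p 0 * q 0 + p 1 * q 1)]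

/-- A unit timelike vector is future directed as soon as it pairs negatively with one point
of `ℍ²`. -/
theorem mem_hypPlane_of_lorentz_neg {r p : Fin 3 → ℝ} (hp : p ∈ hypPlane)
    (hr : lorentz r r = -1) (h : lorentz r p < 0) : r ∈ hypPlane := by
  refine ⟨hr, ?_⟩
  by_contra h2
  have h3 : -r ∈ hypPlane := by
    refine ⟨by rw [lorentz_neg_left, lorentz_neg_right, neg_neg, hr], ?_⟩
    rcases (not_lt.1 h2).lt_or_eq with h4 | h4
    · simpa using h4
    · simp only [lorentz, h4] at hr
      nlinarith [sq_nonneg (r 0), sq_nonneg (r 1)]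
  have h4 := one_le_neg_lorentz h3 hp
  rw [lorentz_neg_left] at h4
  linarith

/-- Two vectors orthogonal to a fixed Lorentz-orthonormal pair are linearly dependent. -/
theorem exists_relation_of_orthogonal {a b u v : Fin 3 → ℝ} (ha : lorentz a a = 1)
    (hb : lorentz b b = -1) (hab : lorentz a b = 0) (hua : lorentz u a = 0)
    (hub : lorentz u b = 0) (hva : lorentz v a = 0) (hvb : lorentz v b = 0) :
    ∃ c d : ℝ, (c, d) ≠ (0, 0) ∧ c • u + d • v = 0 := by
  have hdep : ¬ LinearIndependent ℝ ![a, b, u, v] := by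
    intro h
    have := h.fintype_card_le_finrank
    simp at this
  rw [Fintype.not_linearIndependent_iff] at hdep
  obtain ⟨k, hk, i, hi⟩ := hdep
  simp only [Fin.sum_univ_four, Matrix.cons_val_zero, Matrix.cons_val_one, Matrix.cons_val] at hk
  have h0 : k 0 = 0 := by
    have := congrArg (fun w => lorentz w a) hk
    simp only [lorentz_add_left, lorentz_smul_left, ha, hua, hva, lorentz_comm b a, hab] at this
    simpa [lorentz] using this
  have h1 : k 1 = 0 := by
    have := congrArg (fun w => lorentz w b) hk
    simp only [lorentz_add_left, lorentz_smul_left, hb, hub, hvb, hab] at this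
    simpa [lorentz] using this
  refine ⟨k 2, k 3, ?_, by simpa [h0, h1] using hk⟩
  intro h
  rw [Prod.mk.injEq] at h
  fin_cases i
  · exact hi h0
  · exact hi h1
  · exact hi h.1
  · exact hi h.2

/-! ### Isometries of `ℍ² × ℝ` respect the product structure -/

/-- The squared hyperbolic distance. -/
noncomputable def hypDistSq (p q : Fin 3 → ℝ) : ℝ := Real.arcosh (-lorentz p q) ^ 2

theorem sq_ambDist (P Q : HypProd) :
    ambDist P Q ^ 2 = hypDistSq P.1.1 Q.1.1 + (P.1.2 - Q.1.2) ^ 2 := by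
  rw [ambDist, Real.sq_sqrt (by positivity), hypDistSq]

theorem hypDistSq_self {p : Fin 3 → ℝ} (hp : p ∈ hypPlane) : hypDistSq p p = 0 := by
  simp [hypDistSq, hp.1]

theorem hypDistSq_comm (p q : Fin 3 → ℝ) : hypDistSq p q = hypDistSq q p := by
  rw [hypDistSq, lorentz_comm, hypDistSq]

/-- If `m` bisected a nondegenerate hyperbolic segment of length `2s` in the Euclidean sense, a
point at distance `h` from `m` on the perpendicular bisector would satisfy
`cosh h * cosh s = cosh √(h² + s²)`, which fails for large `h`. -/
theorem le_one_of_forall_cosh_mul {s : ℝ} (hs : 0 ≤ s)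
    (H : ∀ h : ℝ, 0 < h → Real.cosh h * Real.cosh s = Real.cosh (Real.sqrt (h ^ 2 + s ^ 2))) :
    Real.cosh s ≤ 1 := by
  have key : ∀ h : ℝ, 0 < h → Real.cosh s ≤ Real.exp (s ^ 2 / (2 * h)) := by
    intro h hh
    set η := s ^ 2 / (2 * h) with hη
    have hη0 : 0 ≤ η := by positivity
    have h1 : Real.sqrt (h ^ 2 + s ^ 2) ≤ h + η := by
      apply Real.sqrt_le_iff.2 ⟨by positivity, ?_⟩
      have : 2 * h * η = s ^ 2 := by rw [hη]; field_simp
      nlinarith [sq_nonneg η]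
    have h2 : Real.cosh (Real.sqrt (h ^ 2 + s ^ 2)) ≤ Real.cosh (h + η) := by
      rw [Real.cosh_le_cosh, abs_of_nonneg (Real.sqrt_nonneg _), abs_of_nonneg (by positivity)]
      exact h1
    have h3 : Real.cosh (h + η) ≤ Real.cosh h * Real.exp η := by
      rw [Real.cosh_add, ← Real.cosh_add_sinh η, mul_add]
      have := Real.sinh_lt_cosh h
      have h4 : 0 ≤ Real.sinh η := Real.sinh_nonneg_iff.2 hη0
      nlinarith
    have h4 := (H h hh).le.trans (h2.trans h3)
    exact le_of_mul_le_mul_left h4 (Real.cosh_pos h)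
  by_contra hcon
  push Not at hcon
  have hlog : 0 < Real.log (Real.cosh s) := Real.log_pos hcon
  have hs0 : 0 < s := by
    rcases hs.lt_or_eq with h | h
    · exact h
    · rw [← h] at hcon; simp at hcon
  have h1 := key (s ^ 2 / Real.log (Real.cosh s)) (by positivity)
  have h2 : s ^ 2 / (2 * (s ^ 2 / Real.log (Real.cosh s))) = Real.log (Real.cosh s) / 2 := by
    field_simp
  rw [h2, ← Real.log_le_iff_le_exp (by positivity)] at h1
  linarith

/-- In `ℍ²` the parallelogram identity fails for every nondegenerate segment. -/
theorem eq_of_forall_hypDistSq {p q m : Fin 3 → ℝ} (hp : p ∈ hypPlane) (hq : q ∈ hypPlane)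
    (hm : m ∈ hypPlane)
    (H : ∀ r ∈ hypPlane, hypDistSq r m =
      hypDistSq r p / 2 + hypDistSq r q / 2 - hypDistSq p q / 4) : p = q := by
  have hpm := one_le_neg_lorentz hp hm
  have hqm := one_le_neg_lorentz hq hm
  have hpq := one_le_neg_lorentz hp hq
  set s := Real.arcosh (-lorentz p m) with hs
  have hs0 : 0 ≤ s := Real.arcosh_nonneg hpm
  have Hp := H p hp
  have Hq := H q hq
  rw [hypDistSq_self hp] at Hp
  rw [hypDistSq_self hq, hypDistSq_comm q p] at Hq
  have hpq2 : Real.arcosh (-lorentz p q) = 2 * s := by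
    have : Real.arcosh (-lorentz p q) ^ 2 = (2 * s) ^ 2 := by
      simp only [hypDistSq] at Hp
      rw [hs]; linarith
    exact (pow_left_inj₀ (Real.arcosh_nonneg hpq) (by positivity) two_ne_zero).1 this
  have hqm2 : Real.arcosh (-lorentz q m) = s := by
    have : Real.arcosh (-lorentz q m) ^ 2 = s ^ 2 := by
      simp only [hypDistSq] at Hp Hq
      rw [hs]; linarith
    exact (pow_left_inj₀ (Real.arcosh_nonneg hqm) hs0 two_ne_zero).1 this
  have e1 : lorentz p m = -Real.cosh s := by rw [hs, Real.cosh_arcosh hpm, neg_neg]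
  have e2 : lorentz q m = -Real.cosh s := by rw [← hqm2, Real.cosh_arcosh hqm, neg_neg]
  have e3 : lorentz p q = -Real.cosh (2 * s) := by rw [← hpq2, Real.cosh_arcosh hpq, neg_neg]
  have hc2 : Real.cosh (2 * s) = 2 * Real.cosh s ^ 2 - 1 := by
    rw [Real.cosh_two_mul]; have := Real.cosh_sq s; linarith
  -- the geodesic midpoint is the normalized sum
  have hsum : p + q - (2 * Real.cosh s) • m = 0 := by
    apply eq_zero_of_orthogonal hm
    · rw [lorentz_sub_left, lorentz_add_left, lorentz_smul_left, e1, e2, hm.1]; ring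
    · simp only [lorentz_sub_left, lorentz_add_left, lorentz_smul_left, lorentz_sub_right,
        lorentz_add_right, lorentz_smul_right, e1, e2, e3, hm.1, hp.1, hq.1, lorentz_comm q p,
        lorentz_comm m p, lorentz_comm m q, hc2]
      ring
  by_contra hne
  have hgt : 1 < Real.cosh (2 * s) := by
    rcases (show 1 ≤ Real.cosh (2 * s) from Real.one_le_cosh _).lt_or_eq with h | h
    · exact h
    · exfalso
      apply hne
      rw [← sub_eq_zero]
      apply eq_zero_of_orthogonal hp
      · rw [lorentz_sub_left, lorentz_comm q p, hp.1, e3, ← h]; ring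
      · simp only [lorentz_sub_left, lorentz_sub_right, lorentz_comm q p, hp.1, hq.1, e3, ← h]
        ring
  -- a unit spacelike vector orthogonal to the plane of `p` and `q`: the Lorentzian cross product
  set l := Real.sqrt (Real.cosh (2 * s) ^ 2 - 1) with hl
  have hl0 : 0 < l := Real.sqrt_pos.2 (by nlinarith)
  have hl2 : l ^ 2 = Real.cosh (2 * s) ^ 2 - 1 := Real.sq_sqrt (by nlinarith)
  set e' : Fin 3 → ℝ := ![p 1 * q 2 - p 2 * q 1, p 2 * q 0 - p 0 * q 2, p 1 * q 0 - p 0 * q 1]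
    with he'
  have hep' : lorentz e' p = 0 := by simp [lorentz, he']; ring
  have heq' : lorentz e' q = 0 := by simp [lorentz, he']; ring
  have hee' : lorentz e' e' = l ^ 2 := by
    have : lorentz e' e' = lorentz p q ^ 2 - lorentz p p * lorentz q q := by
      simp [lorentz, he']; ring
    rw [this, e3, hp.1, hq.1, hl2]; ring
  set e := l⁻¹ • e' with he
  have hep : lorentz e p = 0 := by rw [he, lorentz_smul_left, hep', mul_zero]
  have heq : lorentz e q = 0 := by rw [he, lorentz_smul_left, heq', mul_zero]
  have hee : lorentz e e = 1 := by
    rw [he, lorentz_smul_left, lorentz_smul_right, hee']; field_simp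
  have hem : lorentz e m = 0 := by
    have := congrArg (lorentz e) hsum
    rw [lorentz_sub_right, lorentz_add_right, lorentz_smul_right, hep, heq] at this
    have h0 : lorentz e 0 = 0 := by simp [lorentz]
    rw [h0] at this
    have hc := Real.cosh_pos s
    have : 2 * Real.cosh s * lorentz e m = 0 := by linarith
    rcases mul_eq_zero.1 this with h | h
    · linarith
    · exact h
  have hle := le_one_of_forall_cosh_mul hs0 (fun h hh => by
    set r := Real.cosh h • m + Real.sinh h • e with hr
    have hrm : lorentz r m = -Real.cosh h := by
      rw [hr, lorentz_add_left, lorentz_smul_left, lorentz_smul_left, hm.1, hem]; ring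
    have hrr : lorentz r r = -1 := by
      simp only [hr, lorentz_add_left, lorentz_smul_left, lorentz_add_right, lorentz_smul_right,
        hm.1, hem, hee, lorentz_comm m e]
      have := Real.cosh_sq h
      linarith
    have hrH : r ∈ hypPlane :=
      mem_hypPlane_of_lorentz_neg hm hrr (by rw [hrm]; linarith [Real.cosh_pos h])
    have hrp : lorentz r p = -(Real.cosh h * Real.cosh s) := by
      rw [hr, lorentz_add_left, lorentz_smul_left, lorentz_smul_left, hep, lorentz_comm m p, e1]
      ring
    have hrq : lorentz r q = -(Real.cosh h * Real.cosh s) := by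
      rw [hr, lorentz_add_left, lorentz_smul_left, lorentz_smul_left, heq, lorentz_comm m q, e2]
      ring
    have h1 := H r hrH
    have hge : 1 ≤ Real.cosh h * Real.cosh s := by
      have := one_le_neg_lorentz hrH hp
      rwa [hrp, neg_neg] at this
    simp only [hypDistSq, hrm, hrp, hrq, neg_neg, hpq2, Real.arcosh_cosh hh.le] at h1
    have h2 : Real.arcosh (Real.cosh h * Real.cosh s) = Real.sqrt (h ^ 2 + s ^ 2) := by
      rw [← Real.sqrt_sq (Real.arcosh_nonneg hge)]
      congr 1
      linarith
    rw [← h2, Real.cosh_arcosh hge])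
  have h2 : Real.cosh s = 1 := le_antisymm hle (Real.one_le_cosh s)
  rw [hc2, h2] at hgt
  norm_num at hgt

/-- `P` and `Q` lie on the same vertical line if and only if the parallelogram identity holds for
the segment `PQ`; the latter only refers to the distance. -/
theorem fst_eq_iff_exists_midpoint (P Q : HypProd) :
    P.1.1 = Q.1.1 ↔ ∃ m : HypProd, ∀ R : HypProd, ambDist R m ^ 2 =
      ambDist R P ^ 2 / 2 + ambDist R Q ^ 2 / 2 - ambDist P Q ^ 2 / 4 := by
  constructor
  · intro h
    refine ⟨⟨(P.1.1, (P.1.2 + Q.1.2) / 2), P.2⟩, fun R => ?_⟩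
    have hself : hypDistSq P.1.1 P.1.1 = 0 := hypDistSq_self P.2
    simp only [sq_ambDist, ← h, hself]
    ring
  · rintro ⟨m, hm⟩
    have H : ∀ r ∈ hypPlane, ∀ t : ℝ, hypDistSq r m.1.1 + (t - m.1.2) ^ 2 =
        (hypDistSq r P.1.1 + (t - P.1.2) ^ 2) / 2 + (hypDistSq r Q.1.1 + (t - Q.1.2) ^ 2) / 2 -
          (hypDistSq P.1.1 Q.1.1 + (P.1.2 - Q.1.2) ^ 2) / 4 := by
      intro r hr t
      have := hm ⟨(r, t), hr⟩
      simpa only [sq_ambDist] using this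
    have hmid : m.1.2 = (P.1.2 + Q.1.2) / 2 := by
      have h0 := H _ P.2 0
      have h1 := H _ P.2 1
      linarith
    refine eq_of_forall_hypDistSq P.2 Q.2 m.2 fun r hr => ?_
    have := H r hr 0
    rw [hmid] at this
    linarith

theorem AmbIsometry.fst_eq_of_fst_eq (Φ : AmbIsometry) {P Q : HypProd} (h : P.1.1 = Q.1.1) :
    (Φ.toEquiv P).1.1 = (Φ.toEquiv Q).1.1 := by
  rw [fst_eq_iff_exists_midpoint] at h ⊢
  obtain ⟨m, hm⟩ := h
  refine ⟨Φ.toEquiv m, fun R => ?_⟩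
  obtain ⟨R, rfl⟩ := Φ.toEquiv.surjective R
  simpa only [Φ.dist_eq] using hm R

/-- The inverse of an isometry. -/
def AmbIsometry.symm (Φ : AmbIsometry) : AmbIsometry where
  toEquiv := Φ.toEquiv.symm
  dist_eq P Q := by rw [← Φ.dist_eq, Equiv.apply_symm_apply, Equiv.apply_symm_apply]

/-- The identity isometry. -/
def AmbIsometry.refl : AmbIsometry where
  toEquiv := Equiv.refl _
  dist_eq _ _ := rfl

/-- An isometry moves the two factors separately: it does not increase the hyperbolic distance of
projections because two vertical lines attain their distance at equal heights. -/
theorem AmbIsometry.hypDistSq_eq (Φ : AmbIsometry) (P Q : HypProd) :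
    hypDistSq (Φ.toEquiv P).1.1 (Φ.toEquiv Q).1.1 = hypDistSq P.1.1 Q.1.1 := by
  have main : ∀ (Ψ : AmbIsometry) (P Q : HypProd),
      hypDistSq (Ψ.toEquiv P).1.1 (Ψ.toEquiv Q).1.1 ≤ hypDistSq P.1.1 Q.1.1 := by
    intro Ψ P Q
    let Q' : HypProd := ⟨(Q.1.1, P.1.2), Q.2⟩
    have h1 : (Ψ.toEquiv Q).1.1 = (Ψ.toEquiv Q').1.1 := Ψ.fst_eq_of_fst_eq rfl
    have h2 := congrArg (· ^ 2) (Ψ.dist_eq P Q')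
    simp only [sq_ambDist] at h2
    rw [h1]
    have h3 : (P.1.2 - Q'.1.2) = 0 := sub_self _
    rw [h3] at h2
    have h4 : Q'.1.1 = Q.1.1 := rfl
    rw [h4] at h2
    nlinarith [sq_nonneg ((Ψ.toEquiv P).1.2 - (Ψ.toEquiv Q').1.2)]
  refine le_antisymm (main Φ P Q) ?_
  have := main Φ.symm (Φ.toEquiv P) (Φ.toEquiv Q)
  simpa [AmbIsometry.symm] using this

theorem AmbIsometry.lorentz_eq (Φ : AmbIsometry) (P Q : HypProd) :
    lorentz (Φ.toEquiv P).1.1 (Φ.toEquiv Q).1.1 = lorentz P.1.1 Q.1.1 := by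
  have h := Φ.hypDistSq_eq P Q
  have h1 := one_le_neg_lorentz (Φ.toEquiv P).2 (Φ.toEquiv Q).2
  have h2 := one_le_neg_lorentz P.2 Q.2
  rw [hypDistSq, hypDistSq,
    pow_left_inj₀ (Real.arcosh_nonneg h1) (Real.arcosh_nonneg h2) two_ne_zero] at h
  exact neg_injective (Real.arcosh_injOn h1 h2 h)

theorem AmbIsometry.exists_snd_eq (Φ : AmbIsometry) :
    ∃ σ c : ℝ, (σ = 1 ∨ σ = -1) ∧ ∀ P : HypProd, (Φ.toEquiv P).1.2 = σ * P.1.2 + c := by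
  have hsq : ∀ P Q : HypProd,
      ((Φ.toEquiv P).1.2 - (Φ.toEquiv Q).1.2) ^ 2 = (P.1.2 - Q.1.2) ^ 2 := by
    intro P Q
    have h := congrArg (· ^ 2) (Φ.dist_eq P Q)
    simp only [sq_ambDist, Φ.hypDistSq_eq] at h
    linarith
  have ho : (![0, 0, 1] : Fin 3 → ℝ) ∈ hypPlane := by simp [hypPlane, lorentz]
  let o : HypProd := ⟨(![0, 0, 1], 0), ho⟩
  let i : HypProd := ⟨(![0, 0, 1], 1), ho⟩
  have ho2 : o.1.2 = 0 := rfl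
  have hi2 : i.1.2 = 1 := rfl
  have h1 := hsq i o
  rw [ho2, hi2] at h1
  set σ := (Φ.toEquiv i).1.2 - (Φ.toEquiv o).1.2 with hσ
  have hσ1 : σ ^ 2 = 1 := by rw [h1]; norm_num
  refine ⟨σ, (Φ.toEquiv o).1.2, sq_eq_sq_iff_eq_or_eq_neg.1 (hσ1.trans (one_pow 2).symm),
    fun P => ?_⟩
  have h2 := hsq P o
  have h3 := hsq P i
  rw [ho2] at h2
  rw [hi2] at h3
  have h4 : (Φ.toEquiv P).1.2 - (Φ.toEquiv i).1.2 =
      (Φ.toEquiv P).1.2 - (Φ.toEquiv o).1.2 - σ := by rw [hσ]; ring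
  rw [h4] at h3
  have h5 : σ * ((Φ.toEquiv P).1.2 - (Φ.toEquiv o).1.2) = P.1.2 := by linarith
  rw [← h5, ← mul_assoc, ← sq, hσ1]
  ring

/-! ### One-variable calculus on open intervals -/

/-- A smooth function on an open interval has a smooth antiderivative. -/
theorem exists_antiderivative {I : Set ℝ} (hI : IsOpen I) (hI' : I.OrdConnected) {v : ℝ → ℝ}
    (hv : ContDiffOn ℝ ∞ v I) :
    ∃ s : ℝ → ℝ, ContDiffOn ℝ ∞ s I ∧ ∀ x ∈ I, HasDerivAt s (v x) x := by
  rcases I.eq_empty_or_nonempty with rfl | ⟨x₀, hx₀⟩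
  · exact ⟨0, by simp, by simp⟩
  have hd : ∀ x ∈ I, HasDerivAt (fun x => ∫ t in x₀..x, v t) (v x) x := by
    intro x hx
    refine intervalIntegral.integral_hasDerivAt_right ?_ ?_ ?_
    · exact (hv.continuousOn.mono (hI'.uIcc_subset hx₀ hx)).intervalIntegrable
    · exact hv.continuousOn.stronglyMeasurableAtFilter hI x hx
    · exact hv.continuousOn.continuousAt (hI.mem_nhds hx)
  refine ⟨_, ?_, hd⟩
  rw [contDiffOn_infty_iff_deriv_of_isOpen hI]
  refine ⟨fun x hx => (hd x hx).differentiableAt.differentiableWithinAt, hv.congr ?_⟩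
  intro x hx
  exact (hd x hx).deriv

/-- The change of variable whose derivative is `1 / v`: the inverse of an antiderivative of `v`. -/
theorem exists_change_of_variable {I : Set ℝ} (hI : IsOpen I) (hI' : I.OrdConnected)
    {v : ℝ → ℝ} (hv : ContDiffOn ℝ ∞ v I) (hpos : ∀ x ∈ I, 0 < v x) :
    ∃ e : OpenPartialHomeomorph ℝ ℝ, e.source.OrdConnected ∧ e.target = I ∧
      ContDiffOn ℝ ∞ e e.source ∧ ContDiffOn ℝ ∞ e.symm e.target ∧
      ∀ x ∈ e.source, HasDerivAt e (v (e x))⁻¹ x := by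
  obtain ⟨s, hs, hds⟩ := exists_antiderivative hI hI' hv
  have hmono : StrictMonoOn s I := by
    refine strictMonoOn_of_deriv_pos hI'.convex hs.continuousOn fun x hx => ?_
    rw [(hds x (interior_subset hx)).deriv]
    exact hpos x (interior_subset hx)
  have hopen : IsOpenMap (I.domRestrict s) := by
    rw [isOpenMap_iff_nhds_le]
    intro x
    have h1 : HasStrictDerivAt s (v x) x := by
      have := (hs.contDiffAt (hI.mem_nhds x.2)).hasStrictDerivAt (by simp)
      rwa [(hds x x.2).deriv] at this
    have h2 := h1.map_nhds_eq (hpos x x.2).ne'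
    have h3 : Filter.map (I.domRestrict s) (nhds x) = nhds (s x) := by
      rw [← h2, ← map_nhds_subtype_coe_eq_nhds x.2 (hI.mem_nhds x.2), Filter.map_map]
      rfl
    exact h3.ge
  let d := OpenPartialHomeomorph.ofContinuousOpenRestrict (hmono.injOn.toPartialEquiv s I)
    hs.continuousOn hopen hI
  have hd : ∀ y ∈ d.target, HasDerivAt d (v (d.symm y)) (d.symm y) := fun y hy =>
    hds _ (d.map_target hy)
  refine ⟨d.symm, ?_, rfl, ?_, hs, ?_⟩
  · have h1 : IsPreconnected (s '' I) := hI'.isPreconnected.image s hs.continuousOn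
    exact h1.ordConnected
  · intro y hy
    exact (d.contDiffAt_symm_deriv (hpos _ (d.map_target hy)).ne' hy (hd y hy)
      (hs.contDiffAt (hI.mem_nhds (d.map_target hy)))).contDiffWithinAt
  · intro y hy
    exact d.hasDerivAt_symm hy (hpos _ (d.map_target hy)).ne' (hd y hy)

/-! ### The inverse function theorem and functional dependence -/

/-- The inverse function theorem, as a local diffeomorphism that is smooth in both directions. -/
theorem exists_local_diffeo {E G : Type*} [NormedAddCommGroup E] [NormedSpace ℝ E]
    [CompleteSpace E] [NormedAddCommGroup G] [NormedSpace ℝ G] {f : E → G} {Ω : Set E}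
    (hΩ : IsOpen Ω) (hf : ContDiffOn ℝ ∞ f Ω) {z : E} (hz : z ∈ Ω) {f' : E ≃L[ℝ] G}
    (hf' : fderiv ℝ f z = f') :
    ∃ e : OpenPartialHomeomorph E G, z ∈ e.source ∧ e.source ⊆ Ω ∧ (∀ w, e w = f w) ∧
      ContDiffOn ℝ ∞ e.symm e.target := by
  have hfz := hf.contDiffAt (hΩ.mem_nhds hz)
  have hd : HasFDerivAt f (f' : E →L[ℝ] G) z := by
    rw [← hf']; exact (hfz.differentiableAt (by simp)).hasFDerivAt
  let e₀ := hfz.toOpenPartialHomeomorph f hd (by simp)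
  have hcont : ContinuousOn (fderiv ℝ f) Ω := hf.continuousOn_fderiv_of_isOpen hΩ (by simp)
  have hS := hcont.isOpen_inter_preimage hΩ
    (ContinuousLinearEquiv.isOpen (𝕜 := ℝ) (E := E) (F := G))
  refine ⟨e₀.restrOpen _ hS, ?_, ?_, fun w => rfl, ?_⟩
  · rw [OpenPartialHomeomorph.restrOpen_source]
    exact ⟨hfz.mem_toOpenPartialHomeomorph_source hd (by simp), hz, f', hf'.symm⟩
  · rw [OpenPartialHomeomorph.restrOpen_source]
    exact fun w hw => hw.2.1
  · intro y hy
    have h1 := (e₀.restrOpen _ hS).map_target hy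
    rw [OpenPartialHomeomorph.restrOpen_source] at h1
    obtain ⟨-, h2, f₁, h3⟩ := h1
    have h4 := hf.contDiffAt (hΩ.mem_nhds h2)
    refine ((e₀.restrOpen _ hS).contDiffAt_symm (f₀' := f₁) hy ?_ h4).contDiffWithinAt
    rw [h3]
    exact (h4.differentiableAt (by simp)).hasFDerivAt

/-- Two functions with independent differentials at a point are coordinates on a rectangle. -/
theorem exists_coordinates {Ω : Set (ℝ × ℝ)} (hΩ : IsOpen Ω) {h k : ℝ × ℝ → ℝ}
    (hh : ContDiffOn ℝ ∞ h Ω) (hk : ContDiffOn ℝ ∞ k Ω) {z : ℝ × ℝ} (hz : z ∈ Ω)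
    (hind : ∀ v, fderiv ℝ h z v = 0 → fderiv ℝ k z v = 0 → v = 0) {U : Set ℝ}
    (hU : U ∈ nhds (h z)) :
    ∃ (e : OpenPartialHomeomorph (ℝ × ℝ) (ℝ × ℝ)) (I J : Set ℝ), IsOpen I ∧ IsOpen J ∧
      I.OrdConnected ∧ J.OrdConnected ∧ I ⊆ U ∧ e.source = I ×ˢ J ∧ e.target ⊆ Ω ∧ z ∈ e.target ∧
      (∀ w, e.symm w = (h w, k w)) ∧ ContDiffOn ℝ ∞ e e.source := by
  have hhz := (hh.contDiffAt (hΩ.mem_nhds hz)).differentiableAt (by simp)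
  have hkz := (hk.contDiffAt (hΩ.mem_nhds hz)).differentiableAt (by simp)
  have hfd : fderiv ℝ (fun w => (h w, k w)) z = (fderiv ℝ h z).prod (fderiv ℝ k z) :=
    hhz.fderiv_prodMk hkz
  have hinj : Function.Injective ((fderiv ℝ h z).prod (fderiv ℝ k z)) := by
    rw [injective_iff_map_eq_zero]
    intro v hv
    rw [ContinuousLinearMap.prod_apply, Prod.mk_eq_zero] at hv
    exact hind v hv.1 hv.2
  let f' : (ℝ × ℝ) ≃L[ℝ] (ℝ × ℝ) :=
    (LinearEquiv.ofInjectiveEndo ((fderiv ℝ h z).prod (fderiv ℝ k z) : (ℝ × ℝ) →ₗ[ℝ] (ℝ × ℝ))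
      hinj).toContinuousLinearEquiv
  have hf' : fderiv ℝ (fun w => (h w, k w)) z = f' := by
    rw [hfd]; ext <;> rfl
  obtain ⟨e, hze, heΩ, he, hes⟩ := exists_local_diffeo hΩ (hh.prodMk hk) hz hf'
  have hmem : e.target ∩ (U ×ˢ Set.univ) ∈ nhds ((h z, k z) : ℝ × ℝ) := by
    refine Filter.inter_mem ?_ (prod_mem_nhds hU Filter.univ_mem)
    rw [← he z]
    exact e.open_target.mem_nhds (e.map_source hze)
  obtain ⟨r, hr, hball⟩ := Metric.mem_nhds_iff.1 hmem
  rw [← ball_prod_same] at hball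
  have ho : IsOpen (Metric.ball (h z) r ×ˢ Metric.ball (k z) r) :=
    Metric.isOpen_ball.prod Metric.isOpen_ball
  have hsrc : (e.symm.restrOpen _ ho).source = Metric.ball (h z) r ×ˢ Metric.ball (k z) r := by
    rw [OpenPartialHomeomorph.restrOpen_source]
    exact Set.inter_eq_right.2 fun w hw => (hball hw).1
  have hball0 : ∀ c : ℝ, (Metric.ball c r).OrdConnected := fun c =>
    (convex_ball c r).ordConnected
  refine ⟨e.symm.restrOpen _ ho, Metric.ball (h z) r, Metric.ball (k z) r, Metric.isOpen_ball,
    Metric.isOpen_ball, hball0 _, hball0 _, ?_, hsrc, ?_, ?_, he, ?_⟩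
  · intro s hs
    exact (hball (Set.mk_mem_prod hs (Metric.mem_ball_self hr))).2.1
  · intro w hw
    have := (e.symm.restrOpen _ ho).map_target hw
    have h2 := (e.symm.restrOpen _ ho).right_inv hw
    rw [hsrc] at this
    rw [← h2]
    exact heΩ (e.map_target (hball this).1)
  · have h1 : (h z, k z) ∈ (e.symm.restrOpen _ ho).source := by
      rw [hsrc]; exact ⟨Metric.mem_ball_self hr, Metric.mem_ball_self hr⟩
    have h2 := (e.symm.restrOpen _ ho).map_source h1
    have h3 : (e.symm.restrOpen _ ho) (h z, k z) = z := by
      change e.symm (h z, k z) = z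
      rw [← he z, e.left_inv hze]
    rwa [h3] at h2
  · refine hes.mono ?_
    rw [hsrc]
    exact fun w hw => (hball hw).1

/-- A function on a convex open set is constant along segments on which its derivative in the
direction of the segment vanishes. -/
theorem eq_of_fderiv_eq_zero {E G : Type*} [NormedAddCommGroup E] [NormedSpace ℝ E]
    [NormedAddCommGroup G] [NormedSpace ℝ G] {S : Set E} (hS : IsOpen S) (hS' : Convex ℝ S)
    {K : E → G} (hK : DifferentiableOn ℝ K S) {v : E} (h0 : ∀ w ∈ S, fderiv ℝ K w v = 0)
    {a : E} {r : ℝ} (ha : a ∈ S) (hb : a + r • v ∈ S) : K (a + r • v) = K a := by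
  let l : ℝ → E := fun t => a + t • v
  have hl : ∀ t, HasDerivAt l v t := fun t => by
    simpa [l] using ((hasDerivAt_id t).smul_const v).const_add a
  have hd : ∀ t ∈ l ⁻¹' S, HasDerivAt (fun t => K (l t)) 0 t := by
    intro t ht
    have h1 := ((hK _ ht).differentiableAt (hS.mem_nhds ht)).hasFDerivAt.comp_hasDerivAt t (hl t)
    rwa [h0 _ ht] at h1
  have hlc : Continuous l := by fun_prop
  have hconv : Convex ℝ (l ⁻¹' S) := by
    intro t ht t' ht' x y hx hy hxy
    have := hS' ht ht' hx hy hxy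
    have h2 : x • l t + y • l t' = l (x • t + y • t') := by
      simp only [l, smul_add, smul_smul, smul_eq_mul, add_smul]
      rw [add_add_add_comm, ← add_smul, hxy, one_smul]
    rwa [h2] at this
  have h1 := (hS.preimage hlc).is_const_of_deriv_eq_zero (f := fun t => K (l t))
    hconv.isPreconnected
    (fun t ht => (hd t ht).differentiableAt.differentiableWithinAt)
    (fun t ht => (hd t ht).deriv) (x := r) (y := 0) hb (by simpa [l] using ha)
  simpa [l] using h1

/-- A map whose differential vanishes wherever that of a submersion `h` to the line does is,
locally, a smooth function of `h`. -/
theorem exists_eq_comp {G : Type*} [NormedAddCommGroup G] [NormedSpace ℝ G]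
    {Ω : Set (ℝ × ℝ)} (hΩ : IsOpen Ω) {h : ℝ × ℝ → ℝ} {f : ℝ × ℝ → G}
    (hh : ContDiffOn ℝ ∞ h Ω) (hf : ContDiffOn ℝ ∞ f Ω) {z : ℝ × ℝ} (hz : z ∈ Ω)
    (h0 : fderiv ℝ h z ≠ 0) (hker : ∀ w ∈ Ω, ∀ v, fderiv ℝ h w v = 0 → fderiv ℝ f w v = 0) :
    ∃ (C : ℝ → G) (I : Set ℝ) (Ω' : Set (ℝ × ℝ)), IsOpen I ∧ I.OrdConnected ∧
      ContDiffOn ℝ ∞ C I ∧ IsOpen Ω' ∧ Ω' ⊆ Ω ∧ z ∈ Ω' ∧ ∀ w ∈ Ω', h w ∈ I ∧ f w = C (h w) := by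
  obtain ⟨k, hk⟩ : ∃ k : ℝ × ℝ →L[ℝ] ℝ, ∀ v, fderiv ℝ h z v = 0 → k v = 0 → v = 0 := by
    have hv : ∀ v : ℝ × ℝ, fderiv ℝ h z v =
        v.1 * fderiv ℝ h z (1, 0) + v.2 * fderiv ℝ h z (0, 1) := by
      intro v
      have : v = v.1 • ((1, 0) : ℝ × ℝ) + v.2 • ((0, 1) : ℝ × ℝ) := by ext <;> simp
      conv_lhs => rw [this, map_add, map_smul, map_smul]
      rfl
    by_cases h1 : fderiv ℝ h z (0, 1) = 0
    · refine ⟨ContinuousLinearMap.snd ℝ ℝ ℝ, fun v hv1 hv2 => ?_⟩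
      have h2 : fderiv ℝ h z (1, 0) ≠ 0 := by
        intro h2
        apply h0
        ext
        · simpa using h2
        · simpa using h1
      rw [hv, h1, mul_zero, add_zero] at hv1
      exact Prod.ext ((mul_eq_zero.1 hv1).resolve_right h2) hv2
    · refine ⟨ContinuousLinearMap.fst ℝ ℝ ℝ, fun v hv1 hv2 => ?_⟩
      have hv2' : v.1 = 0 := hv2
      rw [hv, hv2', zero_mul, zero_add] at hv1
      exact Prod.ext hv2' ((mul_eq_zero.1 hv1).resolve_right h1)
  obtain ⟨e, I, J, hI, hJ, hI', hJ', -, hsrc, htgt, hze, he, hes⟩ := exists_coordinates hΩ hh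
    (k := k) k.contDiff.contDiffOn hz (fun v h1 h2 => hk v h1 (by rwa [k.fderiv] at h2))
    Filter.univ_mem
  have hzIJ : (h z, k z) ∈ I ×ˢ J := by
    rw [← he z, ← hsrc]; exact e.map_target hze
  have hmap : Set.MapsTo e (I ×ˢ J) Ω := fun w hw => htgt (e.map_source (hsrc ▸ hw))
  rw [hsrc] at hes
  have hK : ContDiffOn ℝ ∞ (fun w => f (e w)) (I ×ˢ J) := hf.comp hes hmap
  have hsnd : ∀ w ∈ I ×ˢ J, fderiv ℝ (fun w => f (e w)) w (0, 1) = 0 := by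
    intro w hw
    have hwn : I ×ˢ J ∈ nhds w := (hI.prod hJ).mem_nhds hw
    have hde : DifferentiableAt ℝ e w := (hes.contDiffAt hwn).differentiableAt (by simp)
    have hn : Ω ∈ nhds (e w) := hΩ.mem_nhds (hmap hw)
    have hdf : DifferentiableAt ℝ f (e w) := (hf.contDiffAt hn).differentiableAt (by simp)
    have hdh : DifferentiableAt ℝ h (e w) := (hh.contDiffAt hn).differentiableAt (by simp)
    have h1 : fderiv ℝ (fun w => f (e w)) w = (fderiv ℝ f (e w)).comp (fderiv ℝ e w) :=
      fderiv_comp w hdf hde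
    have h2 : fderiv ℝ (fun w => h (e w)) w = (fderiv ℝ h (e w)).comp (fderiv ℝ e w) :=
      fderiv_comp w hdh hde
    have h3 : (fun w => h (e w)) =ᶠ[nhds w] Prod.fst := by
      filter_upwards [hwn] with u hu
      have := e.left_inv (hsrc ▸ hu : u ∈ e.source)
      rw [he] at this
      exact congrArg Prod.fst this
    rw [h3.fderiv_eq, fderiv_fst] at h2
    rw [h1]
    refine hker _ (hmap hw) _ ?_
    exact (congrArg (fun L : ℝ × ℝ →L[ℝ] ℝ => L (0, 1)) h2).symm
  refine ⟨fun s => f (e (s, k z)), I, e.target, hI, hI', ?_, e.open_target, htgt, hze, ?_⟩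
  · refine hK.comp (contDiff_id.prodMk contDiff_const).contDiffOn ?_
    exact fun s hs => ⟨hs, hzIJ.2⟩
  · intro w hw
    have h1 : (h w, k w) ∈ I ×ˢ J := by
      rw [← he w, ← hsrc]; exact e.map_target hw
    refine ⟨h1.1, ?_⟩
    have hbw : (h w, k w) + (k z - k w) • ((0, 1) : ℝ × ℝ) = (h w, k z) := by ext <;> simp
    have h2 := eq_of_fderiv_eq_zero (hI.prod hJ) (hI'.convex.prod hJ'.convex)
      (hK.differentiableOn (by simp)) hsnd h1 (r := k z - k w) (hbw ▸ ⟨h1.1, hzIJ.2⟩)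
    rw [hbw] at h2
    have h3 : e (h w, k w) = w := by rw [← he w]; exact e.right_inv hw
    simp only [h3] at h2
    exact h2.symm

/-! ### Calculus of Lorentzian products -/

section Calculus

variable {E : Type*} [NormedAddCommGroup E] [NormedSpace ℝ E]

theorem differentiableAt_lorentz {u v : E → Fin 3 → ℝ} {z : E} (hu : DifferentiableAt ℝ u z)
    (hv : DifferentiableAt ℝ v z) : DifferentiableAt ℝ (fun z => lorentz (u z) (v z)) z := by
  have hu' := differentiableAt_pi.1 hu
  have hv' := differentiableAt_pi.1 hv
  exact (((hu' 0).mul (hv' 0)).add ((hu' 1).mul (hv' 1))).sub ((hu' 2).mul (hv' 2))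

theorem fderiv_lorentz {u v : E → Fin 3 → ℝ} {z : E} (hu : DifferentiableAt ℝ u z)
    (hv : DifferentiableAt ℝ v z) (w : E) :
    fderiv ℝ (fun z => lorentz (u z) (v z)) z w =
      lorentz (fderiv ℝ u z w) (v z) + lorentz (u z) (fderiv ℝ v z w) := by
  have hu' := fun i => hasFDerivAt_pi'.1 hu.hasFDerivAt i
  have hv' := fun i => hasFDerivAt_pi'.1 hv.hasFDerivAt i
  have h := (((hu' 0).mul (hv' 0)).add ((hu' 1).mul (hv' 1))).sub ((hu' 2).mul (hv' 2))
  have h2 : HasFDerivAt (fun z => lorentz (u z) (v z)) _ z := h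
  rw [h2.fderiv]
  simp [lorentz]
  ring

theorem fderiv_fst_apply {f : E → Amb} {z : E} (hf : DifferentiableAt ℝ f z) (w : E) :
    fderiv ℝ (fun z => (f z).1) z w = (fderiv ℝ f z w).1 := by
  rw [hf.hasFDerivAt.fst.fderiv]; rfl

theorem fderiv_snd_apply {f : E → Amb} {z : E} (hf : DifferentiableAt ℝ f z) (w : E) :
    fderiv ℝ (fun z => (f z).2) z w = (fderiv ℝ f z w).2 := by
  rw [hf.hasFDerivAt.snd.fderiv]; rfl

theorem fderiv_ambMetric {U V : E → Amb} {z : E} (hU : DifferentiableAt ℝ U z)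
    (hV : DifferentiableAt ℝ V z) (w : E) :
    fderiv ℝ (fun z => ambMetric (U z) (V z)) z w =
      ambMetric (fderiv ℝ U z w) (V z) + ambMetric (U z) (fderiv ℝ V z w) := by
  have h1 : HasFDerivAt (fun z => lorentz (U z).1 (V z).1) _ z :=
    (differentiableAt_lorentz hU.fst hV.fst).hasFDerivAt
  have h2 := hU.hasFDerivAt.snd.mul hV.hasFDerivAt.snd
  have h3 : HasFDerivAt (fun z => ambMetric (U z) (V z)) _ z := h1.add h2
  rw [h3.fderiv]
  simp only [add_apply, fderiv_lorentz hU.fst hV.fst, fderiv_fst_apply hU,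
    fderiv_fst_apply hV, ambMetric]
  simp
  ring

theorem contDiffOn_lorentz {u v : E → Fin 3 → ℝ} {s : Set E} (hu : ContDiffOn ℝ ∞ u s)
    (hv : ContDiffOn ℝ ∞ v s) : ContDiffOn ℝ ∞ (fun z => lorentz (u z) (v z)) s := by
  have hu' := fun i => contDiffOn_pi.1 hu i
  have hv' := fun i => contDiffOn_pi.1 hv i
  exact (((hu' 0).mul (hv' 0)).add ((hu' 1).mul (hv' 1))).sub ((hu' 2).mul (hv' 2))

/-- The derivative of a function that is constant on an open set vanishes. -/
theorem fderiv_eq_zero_of_eqOn_const {G : Type*} [NormedAddCommGroup G] [NormedSpace ℝ G]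
    {Ω : Set E} (hΩ : IsOpen Ω) {f : E → G} {c : G} (h : ∀ z ∈ Ω, f z = c) {z : E} (hz : z ∈ Ω) :
    fderiv ℝ f z = 0 := by
  have : f =ᶠ[nhds z] fun _ => c := by
    filter_upwards [hΩ.mem_nhds hz] with w hw using h w hw
  rw [this.fderiv_eq, fderiv_fun_const]
  rfl

/-- Derivative of a moving vector seen in a hyperbolically rotated frame. -/
theorem fderiv_rotation {p q : E → Fin 3 → ℝ} {Φ : E → ℝ} {z : E} (hp : DifferentiableAt ℝ p z)
    (hq : DifferentiableAt ℝ q z) (hΦ : DifferentiableAt ℝ Φ z) (v : E) :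
    fderiv ℝ (fun w => Real.cosh (Φ w) • q w - Real.sinh (Φ w) • p w) z v =
      Real.cosh (Φ z) • fderiv ℝ q z v - Real.sinh (Φ z) • fderiv ℝ p z v +
        fderiv ℝ Φ z v • (Real.sinh (Φ z) • q z - Real.cosh (Φ z) • p z) := by
  have h := (hΦ.hasFDerivAt.cosh.smul hq.hasFDerivAt).sub (hΦ.hasFDerivAt.sinh.smul hp.hasFDerivAt)
  have h' : HasFDerivAt (fun w => Real.cosh (Φ w) • q w - Real.sinh (Φ w) • p w) _ z := h
  rw [h'.fderiv]
  ext i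
  simp
  ring

end Calculus

/-! ### Surfaces in coordinates -/

/-- A surface in `ℍ² × ℝ` in coordinates: an immersion `f` of an open subset of the plane, together
with a unit normal field `n`. -/
structure IsLocalSurface (Ω : Set (ℝ × ℝ)) (f n : ℝ × ℝ → Amb) : Prop where
  isOpen : IsOpen Ω
  smooth : ContDiffOn ℝ ∞ f Ω
  smooth_normal : ContDiffOn ℝ ∞ n Ω
  mem : ∀ z ∈ Ω, (f z).1 ∈ hypPlane
  tangent : ∀ z ∈ Ω, lorentz (f z).1 (n z).1 = 0
  unit : ∀ z ∈ Ω, ambMetric (n z) (n z) = 1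
  normal : ∀ z ∈ Ω, ∀ v, ambMetric (n z) (fderiv ℝ f z v) = 0
  injective : ∀ z ∈ Ω, ∀ v, fderiv ℝ f z v = 0 → v = 0

namespace IsLocalSurface

variable {Ω : Set (ℝ × ℝ)} {f n : ℝ × ℝ → Amb} {z : ℝ × ℝ}

theorem mono (S : IsLocalSurface Ω f n) {Ω' : Set (ℝ × ℝ)} (hΩ' : IsOpen Ω') (h : Ω' ⊆ Ω) :
    IsLocalSurface Ω' f n :=
  ⟨hΩ', S.smooth.mono h, S.smooth_normal.mono h, fun z hz => S.mem z (h hz),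
    fun z hz => S.tangent z (h hz), fun z hz => S.unit z (h hz), fun z hz => S.normal z (h hz),
    fun z hz => S.injective z (h hz)⟩

theorem differentiableAt (S : IsLocalSurface Ω f n) (hz : z ∈ Ω) : DifferentiableAt ℝ f z :=
  (S.smooth.contDiffAt (S.isOpen.mem_nhds hz)).differentiableAt (by simp)

theorem differentiableAt_normal (S : IsLocalSurface Ω f n) (hz : z ∈ Ω) :
    DifferentiableAt ℝ n z :=
  (S.smooth_normal.contDiffAt (S.isOpen.mem_nhds hz)).differentiableAt (by simp)

theorem lorentz_fderiv (S : IsLocalSurface Ω f n) (hz : z ∈ Ω) (v : ℝ × ℝ) :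
    lorentz (fderiv ℝ f z v).1 (f z).1 = 0 := by
  have h := fderiv_eq_zero_of_eqOn_const S.isOpen (fun z hz => (S.mem z hz).1) hz
  have h2 := fderiv_lorentz (S.differentiableAt hz).fst (S.differentiableAt hz).fst v
  rw [h, fderiv_fst_apply (S.differentiableAt hz), lorentz_comm (f z).1] at h2
  simp only [zero_apply] at h2
  linarith

theorem lorentz_fderiv_normal (S : IsLocalSurface Ω f n) (hz : z ∈ Ω) (v : ℝ × ℝ) :
    lorentz (fderiv ℝ n z v).1 (f z).1 = -lorentz (n z).1 (fderiv ℝ f z v).1 := by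
  have h := fderiv_eq_zero_of_eqOn_const S.isOpen (fun z hz => S.tangent z hz) hz
  have h2 := fderiv_lorentz (S.differentiableAt hz).fst (S.differentiableAt_normal hz).fst v
  rw [h, fderiv_fst_apply (S.differentiableAt hz), fderiv_fst_apply (S.differentiableAt_normal hz),
    lorentz_comm (f z).1, lorentz_comm _ (n z).1] at h2
  simp only [zero_apply] at h2
  linarith

theorem ambMetric_fderiv_normal (S : IsLocalSurface Ω f n) (hz : z ∈ Ω) (v : ℝ × ℝ) :
    ambMetric (fderiv ℝ n z v) (n z) = 0 := by
  have h := fderiv_eq_zero_of_eqOn_const S.isOpen (fun z hz => S.unit z hz) hz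
  have h2 := fderiv_ambMetric (S.differentiableAt_normal hz) (S.differentiableAt_normal hz) v
  rw [h, ambMetric_comm (n z)] at h2
  simp only [zero_apply] at h2
  linarith

/-- The shape operator is self-adjoint: both sides are minus the normal part of the second
derivative of `f`, which is symmetric. -/
theorem ambMetric_fderiv_symm (S : IsLocalSurface Ω f n) (hz : z ∈ Ω) (v w : ℝ × ℝ) :
    ambMetric (fderiv ℝ n z v) (fderiv ℝ f z w) = ambMetric (fderiv ℝ n z w) (fderiv ℝ f z v) := by
  have hfz := S.smooth.contDiffAt (S.isOpen.mem_nhds hz)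
  have hsym := hfz.isSymmSndFDerivAt (by
    rw [minSmoothness_of_isRCLikeNormedField]; exact WithTop.coe_le_coe.2 (le_top : (2 : ℕ∞) ≤ ⊤))
  have hd : DifferentiableAt ℝ (fderiv ℝ f) z :=
    (hfz.fderiv_right (m := 1) (by norm_cast)).differentiableAt (by simp)
  have key : ∀ v w : ℝ × ℝ, ambMetric (fderiv ℝ n z v) (fderiv ℝ f z w) =
      -ambMetric (n z) (fderiv ℝ (fderiv ℝ f) z v w) := by
    intro v w
    have h := fderiv_eq_zero_of_eqOn_const S.isOpen (fun z hz => S.normal z hz w) hz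
    have hdw : HasFDerivAt (fun z => fderiv ℝ f z w) _ z := hd.hasFDerivAt.clm_apply
      (hasFDerivAt_const w z)
    have h2 := fderiv_ambMetric (S.differentiableAt_normal hz) hdw.differentiableAt v
    rw [h, hdw.fderiv] at h2
    simp at h2
    linarith
  rw [key, key, hsym.eq]

theorem lorentz_normal_self (S : IsLocalSurface Ω f n) (hz : z ∈ Ω) :
    lorentz (n z).1 (n z).1 = 1 - (n z).2 ^ 2 := by
  have := S.unit z hz
  simp only [ambMetric] at this
  linarith

theorem lorentz_normal_fderiv (S : IsLocalSurface Ω f n) (hz : z ∈ Ω) (v : ℝ × ℝ) :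
    lorentz (n z).1 (fderiv ℝ f z v).1 = -((n z).2 * (fderiv ℝ f z v).2) := by
  have := S.normal z hz v
  simp only [ambMetric] at this
  linarith

end IsLocalSurface

/-- The coordinate vector `τ` represents the tangential part `T` of `∂_t`, and it is an eigenvector
of the shape operator with eigenvalue `k`. -/
def IsPrincipalAt (f n : ℝ × ℝ → Amb) (z τ : ℝ × ℝ) (k : ℝ) : Prop :=
  fderiv ℝ f z τ = dt - (n z).2 • n z ∧
    fderiv ℝ n z τ + lorentz (fderiv ℝ n z τ).1 (f z).1 • ((f z).1, 0) = -(k • fderiv ℝ f z τ)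

namespace IsPrincipalAt

variable {Ω : Set (ℝ × ℝ)} {f n : ℝ × ℝ → Amb} {z τ : ℝ × ℝ} {k : ℝ}

theorem height_deriv (h : IsPrincipalAt f n z τ k) : (fderiv ℝ f z τ).2 = 1 - (n z).2 ^ 2 := by
  rw [h.1]; simp [dt]; ring

theorem horizontal_deriv (h : IsPrincipalAt f n z τ k) :
    (fderiv ℝ f z τ).1 = -((n z).2 • (n z).1) := by
  rw [h.1]; simp [dt]

theorem angle_deriv (h : IsPrincipalAt f n z τ k) :
    (fderiv ℝ n z τ).2 = -(k * (1 - (n z).2 ^ 2)) := by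
  have := congrArg Prod.snd h.2
  rw [← h.height_deriv]
  simpa using this

theorem normal_deriv (S : IsLocalSurface Ω f n) (hz : z ∈ Ω) (h : IsPrincipalAt f n z τ k) :
    (fderiv ℝ n z τ).1 =
      (k * (n z).2) • (n z).1 - ((n z).2 * (1 - (n z).2 ^ 2)) • (f z).1 := by
  have h1 := congrArg Prod.fst h.2
  simp only [Prod.fst_add, Prod.smul_fst, Prod.fst_neg, S.lorentz_fderiv_normal hz,
    h.horizontal_deriv, lorentz_neg_right, lorentz_smul_right, S.lorentz_normal_self hz] at h1
  rw [eq_sub_of_add_eq h1]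
  ext i
  simp
  ring

/-- If `T` is principal, the angle is constant to first order along the level curves of the
height. -/
theorem fderiv_normal_snd_eq_zero (S : IsLocalSurface Ω f n) (hz : z ∈ Ω)
    (h : IsPrincipalAt f n z τ k) {v : ℝ × ℝ} (hv : (fderiv ℝ f z v).2 = 0) :
    (fderiv ℝ n z v).2 = 0 := by
  have hdt : dt = fderiv ℝ f z τ + (n z).2 • n z := by rw [h.1]; simp
  have h1 : ambMetric (fderiv ℝ f z v) (fderiv ℝ f z τ) = 0 := by
    rw [← ambMetric_dt, hdt, ambMetric_add_right, ambMetric_smul_right,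
      ambMetric_comm _ (n z), S.normal z hz] at hv
    linarith
  rw [← ambMetric_dt, hdt, ambMetric_add_right, ambMetric_smul_right,
    S.ambMetric_fderiv_normal hz, S.ambMetric_fderiv_symm hz, eq_sub_of_add_eq h.2]
  have h2 : ambMetric ((f z).1, 0) (fderiv ℝ f z v) = 0 := by
    simp only [ambMetric, zero_mul, add_zero]
    rw [lorentz_comm, S.lorentz_fderiv hz]
  have h3 : ∀ (X Y : Amb) (a b : ℝ), ambMetric (-(a • X) - b • Y) (fderiv ℝ f z v) =
      -(a * ambMetric X (fderiv ℝ f z v)) - b * ambMetric Y (fderiv ℝ f z v) := by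
    intro X Y a b
    rw [sub_eq_add_neg, ← neg_smul, ← neg_smul, ambMetric_add_left, ambMetric_smul_left,
      ambMetric_smul_left]
    ring
  rw [h3, h2, ambMetric_comm, h1]
  ring

end IsPrincipalAt

/-! ### The moving frame of a surface whose tangential vertical field is principal -/

/-- The unit vector of `ℝ³₁` in the direction opposite to the horizontal part of the normal; where
`cos θ > 0` it is the direction of the horizontal part of `T`. -/
noncomputable def horizontalDir (n : ℝ × ℝ → Amb) (z : ℝ × ℝ) : Fin 3 → ℝ :=
  -((Real.sqrt (1 - (n z).2 ^ 2))⁻¹ • (n z).1)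

/-- The candidate for the curve `A`: the horizontal direction, rotated back by `φ` of the height. -/
noncomputable def frameA (φ : ℝ → ℝ) (f n : ℝ × ℝ → Amb) (z : ℝ × ℝ) : Fin 3 → ℝ :=
  Real.cosh (φ (f z).2) • horizontalDir n z - Real.sinh (φ (f z).2) • (f z).1

/-- The candidate for the curve `B`: the base point, rotated back by `φ` of the height. -/
noncomputable def frameB (φ : ℝ → ℝ) (f n : ℝ × ℝ → Amb) (z : ℝ × ℝ) : Fin 3 → ℝ :=
  Real.cosh (φ (f z).2) • (f z).1 - Real.sinh (φ (f z).2) • horizontalDir n z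

namespace IsLocalSurface

variable {Ω : Set (ℝ × ℝ)} {f n : ℝ × ℝ → Amb} {z : ℝ × ℝ} {φ : ℝ → ℝ}

theorem contDiffOn_horizontalDir (S : IsLocalSurface Ω f n) (hc : ∀ z ∈ Ω, (n z).2 ^ 2 < 1) :
    ContDiffOn ℝ ∞ (horizontalDir n) Ω := by
  have h1 : ContDiffOn ℝ ∞ (fun z => 1 - (n z).2 ^ 2) Ω :=
    contDiffOn_const.sub (S.smooth_normal.snd.pow 2)
  have h2 : ∀ z ∈ Ω, 1 - (n z).2 ^ 2 ≠ 0 := fun z hz => (sub_pos.2 (hc z hz)).ne'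
  have h3 := (h1.sqrt h2).inv fun z hz => (Real.sqrt_pos.2 (sub_pos.2 (hc z hz))).ne'
  exact (h3.smul S.smooth_normal.fst).neg

theorem differentiableAt_horizontalDir (S : IsLocalSurface Ω f n)
    (hc : ∀ z ∈ Ω, (n z).2 ^ 2 < 1) (hz : z ∈ Ω) : DifferentiableAt ℝ (horizontalDir n) z :=
  ((S.contDiffOn_horizontalDir hc).contDiffAt (S.isOpen.mem_nhds hz)).differentiableAt (by simp)

theorem horizontalDir_self (S : IsLocalSurface Ω f n) (hc : (n z).2 ^ 2 < 1) (hz : z ∈ Ω) :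
    lorentz (horizontalDir n z) (horizontalDir n z) = 1 := by
  have h := Real.sq_sqrt (sub_pos.2 hc).le
  have h' := (Real.sqrt_pos.2 (sub_pos.2 hc)).ne'
  rw [horizontalDir, lorentz_neg_left, lorentz_neg_right, lorentz_smul_left, lorentz_smul_right,
    S.lorentz_normal_self hz]
  field_simp
  linarith

theorem horizontalDir_orthogonal (S : IsLocalSurface Ω f n) (hz : z ∈ Ω) :
    lorentz (horizontalDir n z) (f z).1 = 0 := by
  rw [horizontalDir, lorentz_neg_left, lorentz_smul_left, lorentz_comm, S.tangent z hz]
  ring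

theorem frameA_mem (S : IsLocalSurface Ω f n) (hc : (n z).2 ^ 2 < 1) (hz : z ∈ Ω) :
    frameA φ f n z ∈ deSitter := by
  change lorentz _ _ = 1
  simp only [frameA, lorentz_sub_left, lorentz_sub_right,
    lorentz_smul_left, lorentz_smul_right, S.horizontalDir_self hc hz,
    S.horizontalDir_orthogonal hz, lorentz_comm (f z).1 (horizontalDir n z), (S.mem z hz).1]
  have := Real.cosh_sq (φ (f z).2)
  linarith

theorem frameB_mem (S : IsLocalSurface Ω f n) (hc : (n z).2 ^ 2 < 1) (hz : z ∈ Ω) :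
    frameB φ f n z ∈ hypPlane := by
  refine mem_hypPlane_of_lorentz_neg (S.mem z hz) ?_ ?_
  · simp only [frameB, lorentz_sub_left, lorentz_sub_right,
      lorentz_smul_left, lorentz_smul_right, S.horizontalDir_self hc hz,
      S.horizontalDir_orthogonal hz, lorentz_comm (f z).1 (horizontalDir n z), (S.mem z hz).1]
    have := Real.cosh_sq (φ (f z).2)
    linarith
  · simp only [frameB, lorentz_sub_left, lorentz_smul_left, S.horizontalDir_orthogonal hz,
      (S.mem z hz).1]
    have := Real.cosh_pos (φ (f z).2)
    linarith

theorem frame_orthogonal (S : IsLocalSurface Ω f n) (hc : (n z).2 ^ 2 < 1) (hz : z ∈ Ω) :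
    lorentz (frameA φ f n z) (frameB φ f n z) = 0 := by
  simp only [frameA, frameB, lorentz_sub_left, lorentz_sub_right,
    lorentz_smul_left, lorentz_smul_right, S.horizontalDir_self hc hz,
    S.horizontalDir_orthogonal hz, lorentz_comm (f z).1 (horizontalDir n z), (S.mem z hz).1]
  ring

/-- The base point recovered from the frame. -/
theorem sinh_frameA_add_cosh_frameB (φ : ℝ → ℝ) (f n : ℝ × ℝ → Amb) (z : ℝ × ℝ) :
    Real.sinh (φ (f z).2) • frameA φ f n z + Real.cosh (φ (f z).2) • frameB φ f n z =
      (f z).1 := by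
  have h := Real.cosh_sq (φ (f z).2)
  ext i
  simp only [frameA, frameB, Pi.add_apply, Pi.smul_apply, Pi.sub_apply, smul_eq_mul]
  linear_combination (f z).1 i * h

theorem contDiffOn_height (S : IsLocalSurface Ω f n) {I : Set ℝ}
    (hφ : ContDiffOn ℝ ∞ φ I) (hmap : ∀ z ∈ Ω, (f z).2 ∈ I) :
    ContDiffOn ℝ ∞ (fun z => φ (f z).2) Ω :=
  hφ.comp S.smooth.snd hmap

theorem contDiffOn_frameA (S : IsLocalSurface Ω f n) (hc : ∀ z ∈ Ω, (n z).2 ^ 2 < 1) {I : Set ℝ}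
    (hφ : ContDiffOn ℝ ∞ φ I) (hmap : ∀ z ∈ Ω, (f z).2 ∈ I) : ContDiffOn ℝ ∞ (frameA φ f n) Ω :=
  ((S.contDiffOn_height hφ hmap).cosh.smul (S.contDiffOn_horizontalDir hc)).sub
    ((S.contDiffOn_height hφ hmap).sinh.smul S.smooth.fst)

theorem contDiffOn_frameB (S : IsLocalSurface Ω f n) (hc : ∀ z ∈ Ω, (n z).2 ^ 2 < 1) {I : Set ℝ}
    (hφ : ContDiffOn ℝ ∞ φ I) (hmap : ∀ z ∈ Ω, (f z).2 ∈ I) : ContDiffOn ℝ ∞ (frameB φ f n) Ω :=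
  ((S.contDiffOn_height hφ hmap).cosh.smul S.smooth.fst).sub
    ((S.contDiffOn_height hφ hmap).sinh.smul (S.contDiffOn_horizontalDir hc))

theorem fderiv_height (S : IsLocalSurface Ω f n) (hz : z ∈ Ω)
    (hφ : DifferentiableAt ℝ φ (f z).2) (v : ℝ × ℝ) :
    fderiv ℝ (fun w => φ (f w).2) z v = deriv φ (f z).2 * (fderiv ℝ f z v).2 := by
  have h := hφ.hasDerivAt.comp_hasFDerivAt z (S.differentiableAt hz).hasFDerivAt.snd
  have h2 : HasFDerivAt (fun w => φ (f w).2) _ z := h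
  rw [h2.fderiv]
  simp

theorem fderiv_frameA (S : IsLocalSurface Ω f n) (hc : ∀ z ∈ Ω, (n z).2 ^ 2 < 1) (hz : z ∈ Ω)
    (hφ : DifferentiableAt ℝ φ (f z).2) (v : ℝ × ℝ) :
    fderiv ℝ (frameA φ f n) z v =
      Real.cosh (φ (f z).2) • fderiv ℝ (horizontalDir n) z v -
        Real.sinh (φ (f z).2) • (fderiv ℝ f z v).1 +
        (deriv φ (f z).2 * (fderiv ℝ f z v).2) •
          (Real.sinh (φ (f z).2) • horizontalDir n z - Real.cosh (φ (f z).2) • (f z).1) := by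
  have hΦ : DifferentiableAt ℝ (fun w => φ (f w).2) z :=
    DifferentiableAt.comp z hφ (S.differentiableAt hz).snd
  have h := fderiv_rotation (S.differentiableAt hz).fst (S.differentiableAt_horizontalDir hc hz)
    hΦ v
  rw [S.fderiv_height hz hφ, fderiv_fst_apply (S.differentiableAt hz)] at h
  exact h

theorem fderiv_frameB (S : IsLocalSurface Ω f n) (hc : ∀ z ∈ Ω, (n z).2 ^ 2 < 1) (hz : z ∈ Ω)
    (hφ : DifferentiableAt ℝ φ (f z).2) (v : ℝ × ℝ) :
    fderiv ℝ (frameB φ f n) z v =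
      Real.cosh (φ (f z).2) • (fderiv ℝ f z v).1 -
        Real.sinh (φ (f z).2) • fderiv ℝ (horizontalDir n) z v +
        (deriv φ (f z).2 * (fderiv ℝ f z v).2) •
          (Real.sinh (φ (f z).2) • (f z).1 - Real.cosh (φ (f z).2) • horizontalDir n z) := by
  have hΦ : DifferentiableAt ℝ (fun w => φ (f w).2) z :=
    DifferentiableAt.comp z hφ (S.differentiableAt hz).snd
  have h := fderiv_rotation (S.differentiableAt_horizontalDir hc hz) (S.differentiableAt hz).fst
    hΦ v
  rw [S.fderiv_height hz hφ, fderiv_fst_apply (S.differentiableAt hz)] at h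
  exact h

/-- Along the principal direction `T` the horizontal direction turns only towards the base point:
`p' = κ q` and `q' = κ p`, a hyperbolic rotation. -/
theorem fderiv_horizontalDir (S : IsLocalSurface Ω f n) (hc : ∀ z ∈ Ω, (n z).2 ^ 2 < 1)
    (hz : z ∈ Ω) {τ : ℝ × ℝ} {k : ℝ} (hτ : IsPrincipalAt f n z τ k) :
    fderiv ℝ (horizontalDir n) z τ =
      ((Real.sqrt (1 - (n z).2 ^ 2))⁻¹ * (n z).2 * (1 - (n z).2 ^ 2)) • (f z).1 := by
  have hpos := sub_pos.2 (hc z hz)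
  have hs := Real.sq_sqrt hpos.le
  have hs' := (Real.sqrt_pos.2 hpos).ne'
  have hn := (S.differentiableAt_normal hz).hasFDerivAt
  have h1 : HasFDerivAt (fun w => 1 - (n w).2 ^ 2) _ z := (hn.snd.pow 2).const_sub 1
  have h2 : HasFDerivAt (fun w => (Real.sqrt (1 - (n w).2 ^ 2))⁻¹) _ z :=
    ((hasDerivAt_inv hs').comp_hasFDerivAt z (h1.sqrt hpos.ne'))
  have h3 : HasFDerivAt (horizontalDir n) _ z := (h2.smul hn.fst).neg
  rw [h3.fderiv]
  have e1 := hτ.angle_deriv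
  have e2 := hτ.normal_deriv S hz
  ext i
  simp [e1, e2]
  set s := Real.sqrt (1 - (n z).2 ^ 2)
  rw [← hs]
  field_simp
  ring

/-- With `φ' = cot θ` as a function of the height, the rotated frame is constant along `T`. -/
theorem fderiv_frame_eq_zero (S : IsLocalSurface Ω f n) (hc : ∀ z ∈ Ω, (n z).2 ^ 2 < 1)
    (hz : z ∈ Ω) {τ : ℝ × ℝ} {k : ℝ} (hτ : IsPrincipalAt f n z τ k)
    (hφ : DifferentiableAt ℝ φ (f z).2)
    (hφ' : deriv φ (f z).2 = (Real.sqrt (1 - (n z).2 ^ 2))⁻¹ * (n z).2) :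
    fderiv ℝ (frameA φ f n) z τ = 0 ∧ fderiv ℝ (frameB φ f n) z τ = 0 := by
  have hpos := sub_pos.2 (hc z hz)
  have hs := Real.sq_sqrt hpos.le
  have hs' := (Real.sqrt_pos.2 hpos).ne'
  have h1 : (fderiv ℝ f z τ).1 =
      ((Real.sqrt (1 - (n z).2 ^ 2))⁻¹ * (n z).2 * (1 - (n z).2 ^ 2)) • horizontalDir n z := by
    rw [hτ.horizontal_deriv, horizontalDir, smul_neg, smul_smul]
    congr 2
    set s := Real.sqrt (1 - (n z).2 ^ 2)
    rw [← hs]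
    field_simp
  rw [S.fderiv_frameA hc hz hφ, S.fderiv_frameB hc hz hφ, S.fderiv_horizontalDir hc hz hτ,
    hτ.height_deriv, h1, hφ']
  constructor <;>
  · ext i
    simp
    ring

/-- Along the level curves of the height the derivatives of the frame are orthogonal to the
frame. -/
theorem lorentz_fderiv_frame (S : IsLocalSurface Ω f n) (hc : ∀ z ∈ Ω, (n z).2 ^ 2 < 1)
    (hz : z ∈ Ω) (hφ : DifferentiableAt ℝ φ (f z).2) {v : ℝ × ℝ} (hv : (fderiv ℝ f z v).2 = 0) :
    lorentz (fderiv ℝ (frameA φ f n) z v) (frameA φ f n z) = 0 ∧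
      lorentz (fderiv ℝ (frameA φ f n) z v) (frameB φ f n z) = 0 ∧
      lorentz (fderiv ℝ (frameB φ f n) z v) (frameA φ f n z) = 0 ∧
      lorentz (fderiv ℝ (frameB φ f n) z v) (frameB φ f n z) = 0 := by
  have hq := S.differentiableAt_horizontalDir hc hz
  have e1 : lorentz (fderiv ℝ (horizontalDir n) z v) (horizontalDir n z) = 0 := by
    have h := fderiv_eq_zero_of_eqOn_const S.isOpen
      (fun z hz => S.horizontalDir_self (hc z hz) hz) hz
    have h2 := fderiv_lorentz hq hq v
    rw [h, lorentz_comm (horizontalDir n z), zero_apply] at h2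
    linarith
  have e2 : lorentz (fderiv ℝ f z v).1 (horizontalDir n z) = 0 := by
    rw [horizontalDir, lorentz_neg_right, lorentz_smul_right, lorentz_comm,
      S.lorentz_normal_fderiv hz, hv]
    ring
  have e3 : lorentz (fderiv ℝ (horizontalDir n) z v) (f z).1 = 0 := by
    have h := fderiv_eq_zero_of_eqOn_const S.isOpen
      (fun z hz => S.horizontalDir_orthogonal hz) hz
    have h2 := fderiv_lorentz hq (S.differentiableAt hz).fst v
    rw [h, fderiv_fst_apply (S.differentiableAt hz), lorentz_comm (horizontalDir n z), e2,
      zero_apply] at h2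
    linarith
  have e4 := S.lorentz_fderiv hz v
  rw [S.fderiv_frameA hc hz hφ, S.fderiv_frameB hc hz hφ, hv, mul_zero, zero_smul, zero_smul,
    add_zero, add_zero]
  simp only [frameA, frameB, lorentz_sub_left, lorentz_sub_right,
    lorentz_smul_left, lorentz_smul_right, e1, e2, e3, e4]
  refine ⟨?_, ?_, ?_, ?_⟩ <;> ring

/-- The frame is not constant along the level curves of the height, because `f` is an
immersion. -/
theorem fderiv_frame_ne_zero (S : IsLocalSurface Ω f n) (hc : ∀ z ∈ Ω, (n z).2 ^ 2 < 1)
    (hz : z ∈ Ω) (hφ : DifferentiableAt ℝ φ (f z).2) {v : ℝ × ℝ} (hv : (fderiv ℝ f z v).2 = 0)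
    (hA : fderiv ℝ (frameA φ f n) z v = 0) (hB : fderiv ℝ (frameB φ f n) z v = 0) : v = 0 := by
  rw [S.fderiv_frameA hc hz hφ, hv, mul_zero, zero_smul, add_zero] at hA
  rw [S.fderiv_frameB hc hz hφ, hv, mul_zero, zero_smul, add_zero] at hB
  apply S.injective z hz
  refine Prod.ext ?_ hv
  have h := Real.cosh_sq (φ (f z).2)
  ext i
  have hA' := congrFun hA i
  have hB' := congrFun hB i
  simp only [Pi.sub_apply, Pi.smul_apply, smul_eq_mul, Pi.zero_apply] at hA' hB'
  simp only [Prod.fst_zero, Pi.zero_apply]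
  linear_combination Real.sinh (φ (f z).2) * hA' + Real.cosh (φ (f z).2) * hB' -
    (fderiv ℝ f z v).1 i * h

end IsLocalSurface

/-- A surface whose field `T` is principal has, in the coordinates given by its height and by
a component of the rotated frame, the rotational form with profile curve `(φ(x), x)`. -/
theorem IsLocalSurface.exists_form {Ω : Set (ℝ × ℝ)} {f n : ℝ × ℝ → Amb}
    (S : IsLocalSurface Ω f n) (hc : ∀ z ∈ Ω, (n z).2 ^ 2 < 1)
    (hP : ∀ z ∈ Ω, ∃ τ k, IsPrincipalAt f n z τ k) {z : ℝ × ℝ} (hz : z ∈ Ω) :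
    ∃ (e : OpenPartialHomeomorph (ℝ × ℝ) (ℝ × ℝ)) (I J : Set ℝ) (A B : ℝ → Fin 3 → ℝ) (φ : ℝ → ℝ),
      IsOpen I ∧ IsOpen J ∧ I.OrdConnected ∧ J.OrdConnected ∧ e.source = I ×ˢ J ∧ e.target ⊆ Ω ∧
      z ∈ e.target ∧ ContDiffOn ℝ ∞ e e.source ∧ ContDiffOn ℝ ∞ e.symm e.target ∧
      ContDiffOn ℝ ∞ A J ∧ ContDiffOn ℝ ∞ B J ∧ ContDiffOn ℝ ∞ φ I ∧
      (∀ y ∈ J, A y ∈ deSitter ∧ B y ∈ hypPlane ∧ lorentz (A y) (B y) = 0 ∧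
        ∃ a b : ℝ, (a, b) ≠ (0, 0) ∧ a • deriv A y + b • deriv B y = 0) ∧
      ∀ x ∈ I, ∀ y ∈ J,
        f (e (x, y)) = (Real.sinh (φ x) • A y + Real.cosh (φ x) • B y, x) := by
  have hdh : ∀ w ∈ Ω, ∀ v, fderiv ℝ (fun w => (f w).2) w v = (fderiv ℝ f w v).2 :=
    fun w hw v => fderiv_snd_apply (S.differentiableAt hw) v
  have hdc : ∀ w ∈ Ω, ∀ v, fderiv ℝ (fun w => (n w).2) w v = (fderiv ℝ n w v).2 :=
    fun w hw v => fderiv_snd_apply (S.differentiableAt_normal hw) v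
  have hdτ : ∀ w ∈ Ω, ∀ τ k, IsPrincipalAt f n w τ k →
      fderiv ℝ (fun w => (f w).2) w τ = 1 - (n w).2 ^ 2 :=
    fun w hw τ k h => by rw [hdh w hw, h.height_deriv]
  obtain ⟨τ, k, hτ⟩ := hP z hz
  have hpos := sub_pos.2 (hc z hz)
  -- the angle is a function of the height
  obtain ⟨C, I₀, Ω₁, hI₀, -, hC, hΩ₁, hΩ₁Ω, hzΩ₁, hC'⟩ := exists_eq_comp S.isOpen S.smooth.snd
    S.smooth_normal.snd hz (fun h0 => by
      have := hdτ z hz τ k hτ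
      rw [h0] at this
      simp only [zero_apply] at this
      linarith) (fun w hw v hv => by
      obtain ⟨τ, k, hτ⟩ := hP w hw
      rw [hdh w hw] at hv
      rw [hdc w hw]
      exact hτ.fderiv_normal_snd_eq_zero S hw hv)
  have hzI₀ := (hC' z hzΩ₁).1
  have hnhds : I₀ ∩ {s | C s ^ 2 < 1} ∈ nhds (f z).2 := by
    refine Filter.inter_mem (hI₀.mem_nhds hzI₀) ?_
    have hcont : ContinuousAt (fun s => C s ^ 2) (f z).2 :=
      (hC.continuousOn.continuousAt (hI₀.mem_nhds hzI₀)).pow 2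
    refine hcont.eventually_lt continuousAt_const ?_
    rw [← (hC' z hzΩ₁).2]
    exact hc z hz
  obtain ⟨r, hr, hball⟩ := Metric.mem_nhds_iff.1 hnhds
  set I₁ := Metric.ball (f z).2 r with hI₁
  have hcotsm : ContDiffOn ℝ ∞ (fun s => (Real.sqrt (1 - C s ^ 2))⁻¹ * C s) I₁ := by
    have hC1 : ContDiffOn ℝ ∞ C I₁ := hC.mono fun s hs => (hball hs).1
    have h1 : ContDiffOn ℝ ∞ (fun s => 1 - C s ^ 2) I₁ := contDiffOn_const.sub (hC1.pow 2)
    refine ((h1.sqrt fun s hs => ?_).inv fun s hs => ?_).mul hC1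
    · exact (sub_pos.2 (hball hs).2).ne'
    · exact (Real.sqrt_pos.2 (sub_pos.2 (hball hs).2)).ne'
  obtain ⟨φ, hφ, hφ'⟩ := exists_antiderivative Metric.isOpen_ball
    (convex_ball (f z).2 r).ordConnected hcotsm
  have hΩ₂ : IsOpen (Ω₁ ∩ (fun w => (f w).2) ⁻¹' I₁) :=
    (S.smooth.snd.continuousOn.mono hΩ₁Ω).isOpen_inter_preimage hΩ₁ Metric.isOpen_ball
  set Ω₂ := Ω₁ ∩ (fun w => (f w).2) ⁻¹' I₁ with hΩ₂def
  have hΩ₂Ω : Ω₂ ⊆ Ω := fun w hw => hΩ₁Ω hw.1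
  have S₂ := S.mono hΩ₂ hΩ₂Ω
  have hc₂ : ∀ w ∈ Ω₂, (n w).2 ^ 2 < 1 := fun w hw => hc w (hΩ₂Ω hw)
  have hzΩ₂ : z ∈ Ω₂ := ⟨hzΩ₁, Metric.mem_ball_self hr⟩
  have hφd : ∀ w ∈ Ω₂, DifferentiableAt ℝ φ (f w).2 := fun w hw =>
    (hφ' _ hw.2).differentiableAt
  have hφd' : ∀ w ∈ Ω₂, deriv φ (f w).2 = (Real.sqrt (1 - (n w).2 ^ 2))⁻¹ * (n w).2 := by
    intro w hw
    rw [(hφ' _ hw.2).deriv, (hC' w hw.1).2]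
  have hAs := S₂.contDiffOn_frameA hc₂ hφ fun w hw => hw.2
  have hBs := S₂.contDiffOn_frameB hc₂ hφ fun w hw => hw.2
  have hAd : ∀ w ∈ Ω₂, DifferentiableAt ℝ (frameA φ f n) w := fun w hw =>
    (hAs.contDiffAt (hΩ₂.mem_nhds hw)).differentiableAt (by simp)
  have hBd : ∀ w ∈ Ω₂, DifferentiableAt ℝ (frameB φ f n) w := fun w hw =>
    (hBs.contDiffAt (hΩ₂.mem_nhds hw)).differentiableAt (by simp)
  let u : ℝ × ℝ → (Fin 3 → ℝ) × (Fin 3 → ℝ) := fun w => (frameA φ f n w, frameB φ f n w)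
  have hu : ContDiffOn ℝ ∞ u Ω₂ := hAs.prodMk hBs
  have hud : ∀ w ∈ Ω₂, ∀ v, fderiv ℝ u w v =
      (fderiv ℝ (frameA φ f n) w v, fderiv ℝ (frameB φ f n) w v) := by
    intro w hw v
    have := (hAd w hw).fderiv_prodMk (hBd w hw)
    exact congrArg (fun L => L v) this
  have huτ : ∀ w ∈ Ω₂, ∀ τ k, IsPrincipalAt f n w τ k → fderiv ℝ u w τ = 0 := by
    intro w hw τ k hτ
    have h := S₂.fderiv_frame_eq_zero hc₂ hw hτ (hφd w hw) (hφd' w hw)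
    rw [hud w hw, h.1, h.2]
    rfl
  -- a component of the frame is a coordinate transversal to the height
  obtain ⟨v₀, hv₀, hv₀'⟩ : ∃ v₀ : ℝ × ℝ, v₀ ≠ 0 ∧ fderiv ℝ (fun w => (f w).2) z v₀ = 0 := by
    have h1 := LinearMap.ker_ne_bot_of_finrank_lt
      (f := (fderiv ℝ (fun w => (f w).2) z : ℝ × ℝ →ₗ[ℝ] ℝ)) (by simp)
    obtain ⟨v, hv, hv'⟩ := Submodule.exists_mem_ne_zero_of_ne_bot h1
    exact ⟨v, hv', hv⟩
  have huv₀ : fderiv ℝ u z v₀ ≠ 0 := by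
    intro h
    rw [hud z hzΩ₂] at h
    exact hv₀ (S₂.fderiv_frame_ne_zero hc₂ hzΩ₂ (hφd z hzΩ₂) (by rw [← hdh z hz, hv₀'])
      (congrArg Prod.fst h) (congrArg Prod.snd h))
  obtain ⟨l, hl⟩ := SeparatingDual.exists_ne_zero (R := ℝ) huv₀
  let y : ℝ × ℝ → ℝ := fun w => l (u w)
  have hy : ContDiffOn ℝ ∞ y Ω₂ := l.contDiff.comp_contDiffOn hu
  have hyd : ∀ w ∈ Ω₂, ∀ v, fderiv ℝ y w v = l (fderiv ℝ u w v) := by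
    intro w hw v
    have h1 := (hu.contDiffAt (hΩ₂.mem_nhds hw)).differentiableAt (by simp)
    have h2 := l.hasFDerivAt.comp w h1.hasFDerivAt
    have h3 : HasFDerivAt y _ w := h2
    rw [h3.fderiv]
    rfl
  have hind : ∀ v, fderiv ℝ (fun w => (f w).2) z v = 0 → fderiv ℝ y z v = 0 → v = 0 := by
    let L : ℝ × ℝ →ₗ[ℝ] ℝ × ℝ := ((fderiv ℝ (fun w => (f w).2) z).prod (fderiv ℝ y z) :
      ℝ × ℝ →L[ℝ] ℝ × ℝ)
    have hL : Function.Surjective L := by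
      rintro ⟨a, b⟩
      refine ⟨(a / (1 - (n z).2 ^ 2)) • τ + (b / l (fderiv ℝ u z v₀)) • v₀, ?_⟩
      rw [map_add, map_smul, map_smul]
      have e1 : L τ = (1 - (n z).2 ^ 2, 0) := Prod.ext (hdτ z hz τ k hτ) (by
        change fderiv ℝ y z τ = 0
        rw [hyd z hzΩ₂, huτ z hzΩ₂ τ k hτ, map_zero])
      have e2 : L v₀ = (0, l (fderiv ℝ u z v₀)) := Prod.ext hv₀' (hyd z hzΩ₂ v₀)
      rw [e1, e2]
      ext
      · simp [hpos.ne']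
      · simp [hl]
    have hL' := LinearMap.injective_iff_surjective.2 hL
    intro v h1 h2
    exact (injective_iff_map_eq_zero L).1 hL' v (Prod.ext h1 h2)
  obtain ⟨e, I, J, hI, hJ, hI', hJ', hIU, hsrc, htgt, hze, he, hes⟩ := exists_coordinates hΩ₂
    S₂.smooth.snd hy hzΩ₂ hind (Metric.ball_mem_nhds _ hr)
  have hmap : ∀ w ∈ I ×ˢ J, e w ∈ Ω₂ := fun w hw => htgt (e.map_source (hsrc ▸ hw))
  have hinv : ∀ w ∈ I ×ˢ J, ((f (e w)).2, y (e w)) = w := by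
    intro w hw
    have := e.left_inv (hsrc ▸ hw : w ∈ e.source)
    rwa [he] at this
  have hIJ := hI.prod hJ
  have hed : ∀ w ∈ I ×ˢ J, DifferentiableAt ℝ e w := fun w hw =>
    ((hsrc ▸ hes : ContDiffOn ℝ ∞ e (I ×ˢ J)).contDiffAt (hIJ.mem_nhds hw)).differentiableAt
      (by simp)
  have hhd : ∀ w ∈ Ω₂, DifferentiableAt ℝ (fun w => (f w).2) w := fun w hw =>
    (S₂.differentiableAt hw).snd
  have hyd' : ∀ w ∈ Ω₂, DifferentiableAt ℝ y w := fun w hw =>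
    (hy.contDiffAt (hΩ₂.mem_nhds hw)).differentiableAt (by simp)
  -- the derivative of `e` inverts the pair of differentials of the coordinates
  have heinv : ∀ w ∈ I ×ˢ J, ∀ v,
      fderiv ℝ e w (fderiv ℝ (fun w => (f w).2) (e w) v, fderiv ℝ y (e w) v) = v := by
    intro w hw v
    have hew : e w ∈ e.target := e.map_source (hsrc ▸ hw)
    have h1 : (fun u => e ((f u).2, y u)) =ᶠ[nhds (e w)] id := by
      filter_upwards [e.open_target.mem_nhds hew] with u hu
      have := e.right_inv hu
      rwa [he] at this
    have h2 : HasFDerivAt (fun u => ((f u).2, y u)) _ (e w) :=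
      (hhd _ (hmap w hw)).hasFDerivAt.prodMk (hyd' _ (hmap w hw)).hasFDerivAt
    have h3 : HasFDerivAt e (fderiv ℝ e w) ((f (e w)).2, y (e w)) := by
      rw [hinv w hw]; exact (hed w hw).hasFDerivAt
    have h4 := (h3.comp (e w) h2).fderiv
    have h5 : fderiv ℝ (e ∘ fun u => ((f u).2, y u)) (e w) = ContinuousLinearMap.id ℝ (ℝ × ℝ) := by
      rw [← fderiv_id]; exact h1.fderiv_eq
    rw [h5] at h4
    exact (congrArg (fun L : ℝ × ℝ →L[ℝ] ℝ × ℝ => L v) h4).symm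
  have hK : ContDiffOn ℝ ∞ (fun w => u (e w)) (I ×ˢ J) := hu.comp (hsrc ▸ hes) hmap
  have hKd : ∀ w ∈ I ×ˢ J, ∀ v, fderiv ℝ (fun w => u (e w)) w v =
      fderiv ℝ u (e w) (fderiv ℝ e w v) := by
    intro w hw v
    have h1 := (hu.contDiffAt (hΩ₂.mem_nhds (hmap w hw))).differentiableAt (by simp)
    have h2 : fderiv ℝ (fun w => u (e w)) w = (fderiv ℝ u (e w)).comp (fderiv ℝ e w) :=
      fderiv_comp w h1 (hed w hw)
    rw [h2]; rfl
  have hKx : ∀ w ∈ I ×ˢ J, fderiv ℝ (fun w => u (e w)) w (1, 0) = 0 := by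
    intro w hw
    obtain ⟨τ, k, hτ⟩ := hP (e w) (hΩ₂Ω (hmap w hw))
    have hne := (sub_pos.2 (hc₂ _ (hmap w hw))).ne'
    have h1 := heinv w hw τ
    rw [hdτ _ (hΩ₂Ω (hmap w hw)) τ k hτ, hyd _ (hmap w hw), huτ _ (hmap w hw) τ k hτ, map_zero]
      at h1
    have h2 : ((1, 0) : ℝ × ℝ) =
        (1 - (n (e w)).2 ^ 2)⁻¹ • ((1 - (n (e w)).2 ^ 2, 0) : ℝ × ℝ) := by
      ext
      · simp [hne]
      · simp
    rw [hKd w hw, h2, map_smul, map_smul, h1, huτ _ (hmap w hw) τ k hτ, smul_zero]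
  have hzIJ : ((f z).2, y z) ∈ I ×ˢ J := by
    rw [← he z, ← hsrc]; exact e.map_target hze
  have hconst : ∀ x ∈ I, ∀ t ∈ J, u (e (x, t)) = u (e ((f z).2, t)) := by
    intro x hx t ht
    have hb : ((f z).2, t) + (x - (f z).2) • ((1, 0) : ℝ × ℝ) = (x, t) := by ext <;> simp
    have := eq_of_fderiv_eq_zero hIJ (hI'.convex.prod hJ'.convex) (hK.differentiableOn (by simp))
      hKx (a := ((f z).2, t)) (r := x - (f z).2) ⟨hzIJ.1, ht⟩ (hb ▸ ⟨hx, ht⟩)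
    rwa [hb] at this
  have hAB : ContDiffOn ℝ ∞ (fun t => u (e ((f z).2, t))) J :=
    hK.comp (contDiff_const.prodMk contDiff_id).contDiffOn fun t ht => ⟨hzIJ.1, ht⟩
  have hABd : ∀ t ∈ J, HasDerivAt (fun t => u (e ((f z).2, t)))
      (fderiv ℝ u (e ((f z).2, t)) (fderiv ℝ e ((f z).2, t) (0, 1))) t := by
    intro t ht
    have hw : ((f z).2, t) ∈ I ×ˢ J := ⟨hzIJ.1, ht⟩
    have h1 := ((hK.contDiffAt (hIJ.mem_nhds hw)).differentiableAt (by simp)).hasFDerivAt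
    have h2 : HasDerivAt (fun t : ℝ => ((f z).2, t)) ((0, 1) : ℝ × ℝ) t :=
      (hasDerivAt_const t (f z).2).prodMk (hasDerivAt_id t)
    have h3 := h1.comp_hasDerivAt t h2
    rwa [hKd _ hw] at h3
  have hlevel : ∀ w ∈ I ×ˢ J, (fderiv ℝ f (e w) (fderiv ℝ e w (0, 1))).2 = 0 := by
    intro w hw
    have h1 : (fun w => (f (e w)).2) =ᶠ[nhds w] Prod.fst := by
      filter_upwards [hIJ.mem_nhds hw] with u hu
      exact congrArg Prod.fst (hinv u hu)
    have h2 : fderiv ℝ (fun w => (f (e w)).2) w =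
        (fderiv ℝ (fun w => (f w).2) (e w)).comp (fderiv ℝ e w) :=
      fderiv_comp w (hhd _ (hmap w hw)) (hed w hw)
    rw [h1.fderiv_eq, fderiv_fst] at h2
    rw [← hdh _ (hΩ₂Ω (hmap w hw))]
    exact (congrArg (fun L : ℝ × ℝ →L[ℝ] ℝ => L (0, 1)) h2).symm
  refine ⟨e, I, J, fun t => frameA φ f n (e ((f z).2, t)), fun t => frameB φ f n (e ((f z).2, t)),
    φ, hI, hJ, hI', hJ', hsrc, htgt.trans hΩ₂Ω, hze, hes, ?_, hAB.fst, hAB.snd, hφ.mono hIU,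
    ?_, ?_⟩
  · have : (e.symm : ℝ × ℝ → ℝ × ℝ) = fun w => ((f w).2, y w) := funext he
    rw [this]
    exact (S₂.smooth.snd.prodMk hy).mono htgt
  · intro t ht
    have hw : ((f z).2, t) ∈ I ×ˢ J := ⟨hzIJ.1, ht⟩
    have hw' := hmap _ hw
    refine ⟨S₂.frameA_mem (hc₂ _ hw') hw', S₂.frameB_mem (hc₂ _ hw') hw',
      S₂.frame_orthogonal (hc₂ _ hw') hw', ?_⟩
    have h1 : HasDerivAt (fun t => frameA φ f n (e ((f z).2, t))) _ t :=
      (ContinuousLinearMap.fst ℝ (Fin 3 → ℝ) (Fin 3 → ℝ)).hasFDerivAt.comp_hasDerivAt t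
        (hABd t ht)
    have h2 : HasDerivAt (fun t => frameB φ f n (e ((f z).2, t))) _ t :=
      (ContinuousLinearMap.snd ℝ (Fin 3 → ℝ) (Fin 3 → ℝ)).hasFDerivAt.comp_hasDerivAt t
        (hABd t ht)
    rw [hud _ hw'] at h1 h2
    have h3 := S₂.lorentz_fderiv_frame hc₂ hw' (hφd _ hw') (hlevel _ hw)
    obtain ⟨a, b, hab, h4⟩ := exists_relation_of_orthogonal
      (S₂.frameA_mem (φ := φ) (hc₂ _ hw') hw') (S₂.frameB_mem (φ := φ) (hc₂ _ hw') hw').1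
      (S₂.frame_orthogonal (hc₂ _ hw') hw') h3.1 h3.2.1 h3.2.2.1 h3.2.2.2
    refine ⟨a, b, hab, ?_⟩
    rw [← h4]
    exact congrArg₂ (fun X Y => a • X + b • Y) h1.deriv h2.deriv
  · intro x hx t ht
    have hw : (x, t) ∈ I ×ˢ J := ⟨hx, ht⟩
    have h1 := congrArg Prod.fst (hinv _ hw)
    have h2 := hconst x hx t ht
    have h3 := IsLocalSurface.sinh_frameA_add_cosh_frameB φ f n (e (x, t))
    have hA := congrArg Prod.fst h2
    have hB := congrArg Prod.snd h2
    simp only [u] at hA hB h1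
    rw [hA, hB, h1] at h3
    exact Prod.ext h3.symm h1

/-! ### Tangential decomposition and principal directions -/

/-- The ambient metric is positive definite on vectors tangent to `ℍ² × ℝ`. -/
theorem eq_zero_of_ambMetric_self {V : Amb} {p : Fin 3 → ℝ} (hp : p ∈ hypPlane)
    (h : lorentz V.1 p = 0) (h0 : ambMetric V V = 0) : V = 0 := by
  have h1 := lorentz_self_nonneg_of_orthogonal hp h
  simp only [ambMetric] at h0
  have h2 : V.2 = 0 := by nlinarith [mul_self_nonneg V.2]
  refine Prod.ext (eq_zero_of_orthogonal hp h ?_) h2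
  rw [h2] at h0
  linarith

namespace IsLocalSurface

variable {Ω : Set (ℝ × ℝ)} {f n : ℝ × ℝ → Amb} {z : ℝ × ℝ}

theorem normal_snd_sq_le (S : IsLocalSurface Ω f n) (hz : z ∈ Ω) : (n z).2 ^ 2 ≤ 1 := by
  have h1 := lorentz_self_nonneg_of_orthogonal (S.mem z hz)
    ((lorentz_comm _ _).trans (S.tangent z hz))
  rw [S.lorentz_normal_self hz] at h1
  linarith

/-- A vector tangent to `ℍ² × ℝ` splits into a part tangent to the surface and a normal part: the
derivative of `f`, the normal `n` and the position vector together span `ℝ³₁ × ℝ`. -/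
theorem exists_decomposition (S : IsLocalSurface Ω f n) (hz : z ∈ Ω) {W : Amb}
    (hW : lorentz W.1 (f z).1 = 0) :
    ∃ v, W = fderiv ℝ f z v + ambMetric (n z) W • n z := by
  let L : (ℝ × ℝ) × ℝ × ℝ →ₗ[ℝ] Amb :=
    { toFun := fun x => fderiv ℝ f z x.1 + (x.2.1 • n z + x.2.2 • ((f z).1, 0))
      map_add' := fun x y => by
        simp only [Prod.fst_add, Prod.snd_add, map_add, add_smul]; abel
      map_smul' := fun c x => by
        simp only [Prod.smul_fst, Prod.smul_snd, map_smul, smul_eq_mul, mul_smul, smul_add,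
          RingHom.id_apply] }
  have hL : ∀ x, L x = fderiv ℝ f z x.1 + (x.2.1 • n z + x.2.2 • ((f z).1, 0)) := fun x => rfl
  have hpos : ∀ x, lorentz (L x).1 (f z).1 = -x.2.2 := by
    intro x
    simp only [hL, Prod.fst_add, Prod.smul_fst, lorentz_add_left, lorentz_smul_left,
      S.lorentz_fderiv hz, lorentz_comm (n z).1, S.tangent z hz, (S.mem z hz).1]
    ring
  have hnor : ∀ x, ambMetric (n z) (L x) = x.2.1 := by
    intro x
    have h0 : ambMetric (n z) ((f z).1, 0) = 0 := by
      simp only [ambMetric, lorentz_comm (n z).1, S.tangent z hz]; ring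
    rw [hL, ambMetric_add_right, ambMetric_add_right, ambMetric_smul_right, ambMetric_smul_right,
      S.normal z hz, S.unit z hz, h0]
    ring
  have hinj : Function.Injective L := by
    rw [injective_iff_map_eq_zero]
    intro x hx
    have h1 := hpos x
    have h2 := hnor x
    rw [hx] at h1 h2
    have h3 : x.2.2 = 0 := by
      simp [lorentz] at h1; linarith
    have h4 : x.2.1 = 0 := by
      simp [ambMetric, lorentz] at h2; linarith
    rw [hL, h3, h4, zero_smul, zero_smul, add_zero, add_zero] at hx
    exact Prod.ext (S.injective z hz _ hx) (Prod.ext h4 h3)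
  have hsurj : Function.Surjective L :=
    (LinearMap.injective_iff_surjective_of_finrank_eq_finrank (by simp)).1 hinj
  obtain ⟨x, rfl⟩ := hsurj W
  refine ⟨x.1, ?_⟩
  rw [hpos] at hW
  rw [hnor, hL, neg_eq_zero.1 hW, zero_smul, add_zero]

/-- The tangential part of `∂_t` in coordinates. -/
theorem exists_vertical (S : IsLocalSurface Ω f n) (hz : z ∈ Ω) :
    ∃ τ, fderiv ℝ f z τ = dt - (n z).2 • n z := by
  obtain ⟨τ, hτ⟩ := S.exists_decomposition hz (W := dt) (by simp [dt, lorentz])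
  rw [ambMetric_dt] at hτ
  exact ⟨τ, eq_sub_of_add_eq hτ.symm⟩

/-- `T` is the gradient of the height. -/
theorem height_eq (S : IsLocalSurface Ω f n) (hz : z ∈ Ω) {τ : ℝ × ℝ}
    (hτ : fderiv ℝ f z τ = dt - (n z).2 • n z) (v : ℝ × ℝ) :
    (fderiv ℝ f z v).2 = ambMetric (fderiv ℝ f z v) (fderiv ℝ f z τ) := by
  have hdt : dt = fderiv ℝ f z τ + (n z).2 • n z := by rw [hτ]; simp
  rw [← ambMetric_dt, hdt, ambMetric_add_right, ambMetric_smul_right,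
    ambMetric_comm _ (n z), S.normal z hz]
  ring

/-- The derivative of the normal field in `ℍ² × ℝ` is tangent to the surface. -/
theorem exists_shape (S : IsLocalSurface Ω f n) (hz : z ∈ Ω) (v : ℝ × ℝ) :
    ∃ u, fderiv ℝ n z v + lorentz (fderiv ℝ n z v).1 (f z).1 • ((f z).1, 0) = fderiv ℝ f z u := by
  obtain ⟨u, hu⟩ := S.exists_decomposition hz
    (W := fderiv ℝ n z v + lorentz (fderiv ℝ n z v).1 (f z).1 • ((f z).1, 0)) (by
      simp only [Prod.fst_add, Prod.smul_fst, lorentz_add_left, lorentz_smul_left, (S.mem z hz).1]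
      ring)
  have h0 : ambMetric (n z) ((f z).1, 0) = 0 := by
    simp only [ambMetric, lorentz_comm (n z).1, S.tangent z hz]; ring
  have h1 : ambMetric (n z)
      (fderiv ℝ n z v + lorentz (fderiv ℝ n z v).1 (f z).1 • ((f z).1, 0)) = 0 := by
    rw [ambMetric_add_right, ambMetric_smul_right, h0, ambMetric_comm,
      S.ambMetric_fderiv_normal hz]
    ring
  rw [h1, zero_smul, add_zero] at hu
  exact ⟨u, hu⟩

/-- If the angle is constant to first order along the level curves of the height, then `T` is
principal. -/
theorem exists_isPrincipalAt (S : IsLocalSurface Ω f n) (hz : z ∈ Ω) (hc : (n z).2 ^ 2 < 1)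
    (h : ∀ v, (fderiv ℝ f z v).2 = 0 → (fderiv ℝ n z v).2 = 0) :
    ∃ τ k, IsPrincipalAt f n z τ k := by
  obtain ⟨τ, hτ⟩ := S.exists_vertical hz
  obtain ⟨u, hu⟩ := S.exists_shape hz τ
  have hdt : dt = fderiv ℝ f z τ + (n z).2 • n z := by rw [hτ]; simp
  have hheight := S.height_eq hz hτ
  have hangle : ∀ v, (fderiv ℝ n z v).2 = ambMetric (fderiv ℝ f z u) (fderiv ℝ f z v) := by
    intro v
    have h2 : ambMetric ((f z).1, 0) (fderiv ℝ f z v) = 0 := by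
      simp only [ambMetric, zero_mul, add_zero]
      rw [lorentz_comm, S.lorentz_fderiv hz]
    rw [← ambMetric_dt, hdt, ambMetric_add_right, ambMetric_smul_right,
      S.ambMetric_fderiv_normal hz, S.ambMetric_fderiv_symm hz, ← hu, ambMetric_add_left,
      ambMetric_smul_left, h2]
    ring
  have hττ : ambMetric (fderiv ℝ f z τ) (fderiv ℝ f z τ) ≠ 0 := by
    rw [← hheight, hτ]
    simp only [dt, Prod.snd_sub, Prod.smul_snd, smul_eq_mul]
    nlinarith
  set a := ambMetric (fderiv ℝ f z u) (fderiv ℝ f z τ) / ambMetric (fderiv ℝ f z τ) (fderiv ℝ f z τ)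
    with ha
  -- the component of `u` orthogonal to `τ` vanishes
  have h1 : (fderiv ℝ f z (u + (-a) • τ)).2 = 0 := by
    rw [hheight, map_add, map_smul, ambMetric_add_left, ambMetric_smul_left, ha]
    field_simp
    ring
  have h2 := h _ h1
  have h3 : u + (-a) • τ = 0 := by
    apply S.injective z hz
    apply eq_zero_of_ambMetric_self (S.mem z hz) (S.lorentz_fderiv hz _)
    rw [hangle] at h2
    rw [hheight] at h1
    have h4 : ∀ X, ambMetric (fderiv ℝ f z (u + (-a) • τ)) X =
        ambMetric (fderiv ℝ f z u) X - a * ambMetric (fderiv ℝ f z τ) X := by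
      intro X
      rw [map_add, map_smul, ambMetric_add_left, ambMetric_smul_left]
      ring
    rw [h4, h2, ambMetric_comm, h1]
    ring
  refine ⟨τ, -a, hτ, ?_⟩
  rw [hu, ← sub_eq_zero]
  have := congrArg (fderiv ℝ f z) h3
  rw [map_add, map_smul, map_zero] at this
  rw [← this]
  module

end IsLocalSurface

/-! ### From the surface to coordinates -/

theorem normal_snd_ne_zero {M : Type*} {ξ : M → Amb} {p : M} (h : angle ξ p ≠ Real.pi / 2) :
    (ξ p).2 ≠ 0 := by
  intro h0
  rw [angle, ambMetric_dt, h0, Real.arccos_zero] at h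
  exact h rfl

section Transfer

variable {M : Type*} [TopologicalSpace M] [ChartedSpace (EuclideanSpace ℝ (Fin 2)) M]

/-- A local parametrization of the surface by an open subset of the plane, smooth in both
directions. -/
structure IsSmoothParam (ψ : OpenPartialHomeomorph (ℝ × ℝ) M) : Prop where
  smooth : ContMDiffOn 𝓘(ℝ, ℝ × ℝ) (𝓡 2) ∞ ψ ψ.source
  smooth_symm : ContMDiffOn (𝓡 2) 𝓘(ℝ, ℝ × ℝ) ∞ ψ.symm ψ.target

theorem IsCoordRect.isSmoothParam {I J : Set ℝ} {ψ : OpenPartialHomeomorph (ℝ × ℝ) M}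
    (h : IsCoordRect I J ψ) : IsSmoothParam ψ :=
  ⟨h.smooth, h.smooth_symm⟩

theorem exists_isSmoothParam [IsManifold (𝓡 2) ∞ M] (p : M) :
    ∃ ψ : OpenPartialHomeomorph (ℝ × ℝ) M, IsSmoothParam ψ ∧ p ∈ ψ.target := by
  let L : (ℝ × ℝ) ≃L[ℝ] EuclideanSpace ℝ (Fin 2) := ContinuousLinearEquiv.ofFinrankEq (by simp)
  let c := chartAt (EuclideanSpace ℝ (Fin 2)) p
  refine ⟨L.toHomeomorph.toOpenPartialHomeomorph.trans c.symm, ⟨?_, ?_⟩, ?_⟩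
  · refine (contMDiffOn_chart_symm (I := 𝓡 2) (n := ∞) (x := p)).comp
      (L.contDiff.contMDiff.contMDiffOn) ?_
    intro x hx
    simpa using hx
  · refine (L.symm.contDiff.contMDiff).comp_contMDiffOn
      ((contMDiffOn_chart (I := 𝓡 2) (n := ∞) (x := p)).mono ?_)
    intro x hx
    simpa using hx
  · simp [c]

namespace IsSmoothParam

variable {ψ : OpenPartialHomeomorph (ℝ × ℝ) M} {z : ℝ × ℝ}

theorem mdifferentiable (h : IsSmoothParam ψ) :
    ψ.MDifferentiable 𝓘(ℝ, ℝ × ℝ) (𝓡 2) :=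
  ⟨h.smooth.mdifferentiableOn (by simp), h.smooth_symm.mdifferentiableOn (by simp)⟩

theorem contDiffOn_comp (h : IsSmoothParam ψ) {V : M → Amb}
    (hV : ContMDiff (𝓡 2) 𝓘(ℝ, Amb) ∞ V) : ContDiffOn ℝ ∞ (fun z => V (ψ z)) ψ.source :=
  contMDiffOn_iff_contDiffOn.1 (hV.comp_contMDiffOn h.smooth)

theorem fderiv_comp (h : IsSmoothParam ψ) {V : M → Amb}
    (hV : ContMDiff (𝓡 2) 𝓘(ℝ, Amb) ∞ V) (hz : z ∈ ψ.source) (v : ℝ × ℝ) :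
    fderiv ℝ (fun z => V (ψ z)) z v =
      vecDeriv V (ψ z) (mfderiv 𝓘(ℝ, ℝ × ℝ) (𝓡 2) ψ z v) := by
  have h1 := mfderiv_comp z ((hV (ψ z)).mdifferentiableAt (by simp))
    (h.mdifferentiable.mdifferentiableAt hz)
  rw [mfderiv_eq_fderiv] at h1
  exact congrArg (fun L : ℝ × ℝ →L[ℝ] Amb => L v) h1

theorem mfderiv_eq_zero_iff (h : IsSmoothParam ψ) (hz : z ∈ ψ.source) {v : ℝ × ℝ} :
    mfderiv 𝓘(ℝ, ℝ × ℝ) (𝓡 2) ψ z v = 0 ↔ v = 0 :=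
  map_eq_zero_iff _ (h.mdifferentiable.mfderiv_injective hz)

end IsSmoothParam

variable [IsManifold (𝓡 2) ∞ M] {g : SurfaceMetric M} {F : M → HypProd} {ξ : M → Amb}
  {ψ : OpenPartialHomeomorph (ℝ × ℝ) M} {z : ℝ × ℝ}

theorem inner_tangentPart (V : Amb) (p : M) (w : TangentSpace (𝓡 2) p) :
    g.inner p (tangentPart g F V p) w = ambMetric V (push F p w) :=
  (exists_tangentPart g F V p).choose_spec w

theorem eq_of_forall_inner_eq {p : M} {v w : TangentSpace (𝓡 2) p}
    (h : ∀ u, g.inner p v u = g.inner p w u) : v = w := by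
  by_contra hne
  have h1 := g.pos p (v - w) (sub_ne_zero.2 hne)
  have h2 : g.inner p (v - w) (v - w) = 0 := by
    have h3 : g.inner p (v - w) = 0 := by
      rw [map_sub, sub_eq_zero]
      ext u
      exact h u
    rw [h3]
    rfl
  exact h1.ne' h2

theorem IsIsometricImmersion.isLocalSurface (hF : IsIsometricImmersion g F)
    (hξ : IsUnitNormal F ξ) (hψ : IsSmoothParam ψ) :
    IsLocalSurface ψ.source (fun z => (F (ψ z) : Amb)) (fun z => ξ (ψ z)) where
  isOpen := ψ.open_source
  smooth := hψ.contDiffOn_comp hF.smooth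
  smooth_normal := hψ.contDiffOn_comp hξ.smooth
  mem z _ := (F (ψ z)).2
  tangent z _ := hξ.tangent _
  unit z _ := hξ.unit _
  normal z hz v := by
    rw [hψ.fderiv_comp hF.smooth hz]
    exact hξ.normal _ _
  injective z hz v hv := by
    rw [hψ.fderiv_comp hF.smooth hz] at hv
    rw [← hψ.mfderiv_eq_zero_iff hz]
    by_contra hne
    have h1 := g.pos _ _ hne
    rw [hF.isometric] at h1
    have h2 : push F (ψ z) (mfderiv 𝓘(ℝ, ℝ × ℝ) (𝓡 2) ψ z v) = 0 := hv
    rw [h2] at h1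
    simp [ambMetric, lorentz] at h1

/-- The tangential part is determined by the splitting into tangential and normal parts. -/
theorem IsIsometricImmersion.tangentPart_eq (hF : IsIsometricImmersion g F)
    (hξ : IsUnitNormal F ξ) (hψ : IsSmoothParam ψ) (hz : z ∈ ψ.source) {V : Amb} {v : ℝ × ℝ} {c : ℝ}
    (h : V = fderiv ℝ (fun z => (F (ψ z) : Amb)) z v + c • ξ (ψ z)) :
    tangentPart g F V (ψ z) = mfderiv 𝓘(ℝ, ℝ × ℝ) (𝓡 2) ψ z v := by
  apply eq_of_forall_inner_eq (g := g)
  intro u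
  rw [inner_tangentPart, hF.isometric, h, hψ.fderiv_comp hF.smooth hz, ambMetric_add_left,
    ambMetric_smul_left, hξ.normal, mul_zero, add_zero]
  rfl

/-- Being a principal direction for the field `T`, read in coordinates. -/
theorem isPrincipalDirection_iff (hF : IsIsometricImmersion g F) (hξ : IsUnitNormal F ξ)
    (hψ : IsSmoothParam ψ) (hz : z ∈ ψ.source) (hc : (ξ (ψ z)).2 ^ 2 < 1) :
    IsPrincipalDirection g F ξ (ψ z) (fieldT g F (ψ z)) ↔
      ∃ τ k, IsPrincipalAt (fun z => (F (ψ z) : Amb)) (fun z => ξ (ψ z)) z τ k := by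
  have S := hF.isLocalSurface hξ hψ
  obtain ⟨τ, hτ⟩ := S.exists_vertical hz
  obtain ⟨u, hu⟩ := S.exists_shape hz τ
  have hT : fieldT g F (ψ z) = mfderiv 𝓘(ℝ, ℝ × ℝ) (𝓡 2) ψ z τ :=
    hF.tangentPart_eq hξ hψ hz (c := (ξ (ψ z)).2) (by rw [hτ]; simp)
  have hS : shapeOperator g F ξ (ψ z) (mfderiv 𝓘(ℝ, ℝ × ℝ) (𝓡 2) ψ z τ) =
      -mfderiv 𝓘(ℝ, ℝ × ℝ) (𝓡 2) ψ z u := by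
    rw [shapeOperator]
    congr 1
    apply hF.tangentPart_eq hξ hψ hz (c := 0)
    rw [← hu, ambConn, hψ.fderiv_comp hξ.smooth hz, zero_smul, add_zero]
  have hτ0 : τ ≠ 0 := by
    rintro rfl
    have := congrArg Prod.snd hτ
    simp only [map_zero, Prod.snd_zero, dt, Prod.snd_sub, Prod.smul_snd, smul_eq_mul] at this
    nlinarith
  rw [hT, IsPrincipalDirection, hS]
  constructor
  · rintro ⟨-, k, hk⟩
    refine ⟨τ, k, hτ, ?_⟩
    have h1 : mfderiv 𝓘(ℝ, ℝ × ℝ) (𝓡 2) ψ z (u + k • τ) = 0 := by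
      have e1 : mfderiv 𝓘(ℝ, ℝ × ℝ) (𝓡 2) ψ z (u + k • τ) = mfderiv 𝓘(ℝ, ℝ × ℝ) (𝓡 2) ψ z u +
        k • mfderiv 𝓘(ℝ, ℝ × ℝ) (𝓡 2) ψ z τ := by
        erw [map_add, map_smul]
      rw [e1, ← hk, add_neg_cancel]
    rw [hψ.mfderiv_eq_zero_iff hz] at h1
    rw [hu, eq_neg_of_add_eq_zero_left h1, map_neg, map_smul]
  · rintro ⟨τ', k, hτ', hk⟩
    have hττ' : τ' = τ := by
      rw [← sub_eq_zero]
      apply S.injective z hz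
      rw [map_sub, hτ', hτ, sub_self]
    rw [hττ', hu] at hk
    have h1 : u = -(k • τ) := by
      rw [← sub_eq_zero]
      apply S.injective z hz
      rw [map_sub, hk, map_neg, map_smul, sub_self]
    refine ⟨fun h => hτ0 ((hψ.mfderiv_eq_zero_iff hz).1 h), k, ?_⟩
    rw [h1]
    have e1 : mfderiv 𝓘(ℝ, ℝ × ℝ) (𝓡 2) ψ z (-(k • τ)) =
        -(k • mfderiv 𝓘(ℝ, ℝ × ℝ) (𝓡 2) ψ z τ) := by
      erw [map_neg, map_smul]
    rw [e1, neg_neg]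

theorem normal_snd_sq_le (hF : IsIsometricImmersion g F) (hξ : IsUnitNormal F ξ) (p : M) :
    (ξ p).2 ^ 2 ≤ 1 := by
  obtain ⟨ψ, hψ, hp⟩ := exists_isSmoothParam p
  have := (hF.isLocalSurface hξ hψ).normal_snd_sq_le (ψ.map_target hp)
  simpa [ψ.right_inv hp] using this

theorem normal_snd_sq_lt (hF : IsIsometricImmersion g F) (hξ : IsUnitNormal F ξ) {p : M}
    (h0 : angle ξ p ≠ 0) (h1 : angle ξ p ≠ Real.pi) : (ξ p).2 ^ 2 < 1 := by
  refine lt_of_le_of_ne (normal_snd_sq_le hF hξ p) fun h => ?_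
  rw [angle, ambMetric_dt] at h0 h1
  rcases sq_eq_sq_iff_eq_or_eq_neg.1 (h.trans (one_pow 2).symm) with h | h
  · rw [h, Real.arccos_one] at h0; exact h0 rfl
  · rw [h, Real.arccos_neg_one] at h1; exact h1 rfl

end Transfer

/-! ### Plane curves -/

theorem sq_speed (φ χ : ℝ → ℝ) (x : ℝ) : speed φ χ x ^ 2 = deriv φ x ^ 2 + deriv χ x ^ 2 :=
  Real.sq_sqrt (by positivity)

theorem speed_pos {φ χ : ℝ → ℝ} {x : ℝ} (h : (deriv φ x, deriv χ x) ≠ (0, 0)) :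
    0 < speed φ χ x := by
  refine Real.sqrt_pos.2 ?_
  by_contra hle
  have h1 := sq_nonneg (deriv φ x)
  have h2 := sq_nonneg (deriv χ x)
  refine h (Prod.ext ?_ ?_) <;> simp only <;> nlinarith

theorem speed_const_mul {ε δ : ℝ} (hε : ε = 1 ∨ ε = -1) (hδ : δ = 1 ∨ δ = -1) (φ χ : ℝ → ℝ)
    (x : ℝ) : speed (fun x => ε * φ x) (fun x => δ * χ x) x = speed φ χ x := by
  rw [speed, speed, deriv_const_mul_field, deriv_const_mul_field]
  rcases hε with rfl | rfl <;> rcases hδ with rfl | rfl <;> simp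

/-- The signed curvature of a unit speed curve is the derivative of its angle function. -/
theorem IsCurveAngle.deriv_eq_curvature {φ χ ϑ : ℝ → ℝ} {I : Set ℝ} (hI : IsOpen I)
    (h : IsCurveAngle φ χ ϑ I) (hu : IsUnitSpeed φ χ I) {x : ℝ} (hx : x ∈ I) :
    deriv ϑ x = curvature φ χ x := by
  have hϑ := ((h.1.contDiffAt (hI.mem_nhds hx)).differentiableAt (by simp)).hasDerivAt
  have h1 : deriv φ =ᶠ[nhds x] fun x => Real.cos (ϑ x) := by
    filter_upwards [hI.mem_nhds hx] with w hw
    rw [(h.2 w hw).1, hu w hw, one_mul]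
  have h2 : deriv χ =ᶠ[nhds x] fun x => Real.sin (ϑ x) := by
    filter_upwards [hI.mem_nhds hx] with w hw
    rw [(h.2 w hw).2, hu w hw, one_mul]
  rw [curvature, h1.deriv_eq, h2.deriv_eq, hϑ.cos.deriv, hϑ.sin.deriv, h1.self_of_nhds,
    h2.self_of_nhds, hu x hx]
  linear_combination -deriv ϑ x * Real.cos_sq_add_sin_sq (ϑ x)

/-! ### The first fundamental form of the explicit form -/

/-- Two maps with the same Lorentzian products have the same first fundamental form. For the
map composed with an isometry this takes the place of the smoothness of the isometry. -/
theorem ambMetric_fderiv_eq {E : Type*} [NormedAddCommGroup E] [NormedSpace ℝ E] {Ω : Set E}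
    (hΩ : IsOpen Ω) {f G : E → Amb} (hf : DifferentiableOn ℝ f Ω) (hG : DifferentiableOn ℝ G Ω)
    (h : ∀ z ∈ Ω, ∀ w ∈ Ω, lorentz (G z).1 (G w).1 = lorentz (f z).1 (f w).1) {σ c : ℝ}
    (hσ : σ = 1 ∨ σ = -1) (h2 : ∀ z ∈ Ω, (G z).2 = σ * (f z).2 + c) {z : E} (hz : z ∈ Ω)
    (v w : E) :
    ambMetric (fderiv ℝ G z v) (fderiv ℝ G z w) = ambMetric (fderiv ℝ f z v) (fderiv ℝ f z w) ∧
      (fderiv ℝ G z v).2 = σ * (fderiv ℝ f z v).2 := by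
  have hfd : ∀ z ∈ Ω, DifferentiableAt ℝ f z := fun z hz =>
    (hf z hz).differentiableAt (hΩ.mem_nhds hz)
  have hGd : ∀ z ∈ Ω, DifferentiableAt ℝ G z := fun z hz =>
    (hG z hz).differentiableAt (hΩ.mem_nhds hz)
  have h3 : ∀ u ∈ Ω, lorentz (fderiv ℝ G z v).1 (G u).1 = lorentz (fderiv ℝ f z v).1 (f u).1 := by
    intro u hu
    have e1 := fderiv_lorentz (hGd z hz).fst (differentiableAt_const (G u).1) v
    have e2 := fderiv_lorentz (hfd z hz).fst (differentiableAt_const (f u).1) v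
    have e3 : (fun z => lorentz (G z).1 (G u).1) =ᶠ[nhds z] fun z => lorentz (f z).1 (f u).1 := by
      filter_upwards [hΩ.mem_nhds hz] with w hw using h w hw u hu
    rw [e3.fderiv_eq, e2, fderiv_fst_apply (hGd z hz), fderiv_fst_apply (hfd z hz)] at e1
    have e0 : ∀ X, lorentz X 0 = 0 := fun X => by simp [lorentz]
    simp [e0] at e1
    exact e1.symm
  have h4 : lorentz (fderiv ℝ G z v).1 (fderiv ℝ G z w).1 =
      lorentz (fderiv ℝ f z v).1 (fderiv ℝ f z w).1 := by
    have e1 := fderiv_lorentz (differentiableAt_const (fderiv ℝ G z v).1) (hGd z hz).fst w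
    have e2 := fderiv_lorentz (differentiableAt_const (fderiv ℝ f z v).1) (hfd z hz).fst w
    have e3 : (fun u => lorentz (fderiv ℝ G z v).1 (G u).1) =ᶠ[nhds z]
        fun u => lorentz (fderiv ℝ f z v).1 (f u).1 := by
      filter_upwards [hΩ.mem_nhds hz] with u hu using h3 u hu
    rw [e3.fderiv_eq, e2, fderiv_fst_apply (hGd z hz), fderiv_fst_apply (hfd z hz)] at e1
    have e0 : ∀ X, lorentz 0 X = 0 := fun X => by simp [lorentz]
    simp [e0] at e1
    exact e1.symm
  have h5 : ∀ v, (fderiv ℝ G z v).2 = σ * (fderiv ℝ f z v).2 := by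
    intro v
    have e3 : (fun u => (G u).2) =ᶠ[nhds z] fun u => σ * (f u).2 + c := by
      filter_upwards [hΩ.mem_nhds hz] with u hu using h2 u hu
    have e4 : HasFDerivAt (fun u => σ * (f u).2 + c) _ z :=
      ((hfd z hz).hasFDerivAt.snd.const_mul σ).add_const c
    rw [← fderiv_snd_apply (hGd z hz), e3.fderiv_eq, e4.fderiv]
    rfl
  refine ⟨?_, h5 v⟩
  rw [ambMetric, ambMetric, h4, h5, h5]
  rcases hσ with rfl | rfl <;> ring

/-- The explicit form of the immersion. -/
noncomputable def explicitForm (A B : ℝ → Fin 3 → ℝ) (φ χ : ℝ → ℝ) (z : ℝ × ℝ) : Amb :=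
  (Real.sinh (φ z.1) • A z.2 + Real.cosh (φ z.1) • B z.2, χ z.1)

theorem hasFDerivAt_explicitForm {A B : ℝ → Fin 3 → ℝ} {φ χ : ℝ → ℝ} {z : ℝ × ℝ}
    (hA : DifferentiableAt ℝ A z.2) (hB : DifferentiableAt ℝ B z.2)
    (hφ : DifferentiableAt ℝ φ z.1) (hχ : DifferentiableAt ℝ χ z.1) :
    ∃ L : ℝ × ℝ →L[ℝ] Amb, HasFDerivAt (explicitForm A B φ χ) L z ∧
      L (1, 0) = (deriv φ z.1 • (Real.cosh (φ z.1) • A z.2 + Real.sinh (φ z.1) • B z.2),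
        deriv χ z.1) ∧
      L (0, 1) = (Real.sinh (φ z.1) • deriv A z.2 + Real.cosh (φ z.1) • deriv B z.2, 0) := by
  have h1 : HasFDerivAt (fun z : ℝ × ℝ => φ z.1) _ z :=
    hφ.hasDerivAt.comp_hasFDerivAt z (ContinuousLinearMap.fst ℝ ℝ ℝ).hasFDerivAt
  have h2 : HasFDerivAt (fun z : ℝ × ℝ => χ z.1) _ z :=
    hχ.hasDerivAt.comp_hasFDerivAt z (ContinuousLinearMap.fst ℝ ℝ ℝ).hasFDerivAt
  have h3 : HasFDerivAt (fun z : ℝ × ℝ => A z.2) _ z :=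
    hA.hasDerivAt.hasFDerivAt.comp z (ContinuousLinearMap.snd ℝ ℝ ℝ).hasFDerivAt
  have h4 : HasFDerivAt (fun z : ℝ × ℝ => B z.2) _ z :=
    hB.hasDerivAt.hasFDerivAt.comp z (ContinuousLinearMap.snd ℝ ℝ ℝ).hasFDerivAt
  refine ⟨_, ((h1.sinh.smul h3).add (h1.cosh.smul h4)).prodMk h2, ?_, ?_⟩
  · refine Prod.ext ?_ ?_
    · ext i; simp; ring
    · simp
  · refine Prod.ext ?_ ?_
    · ext i; simp
    · simp

section LocalForm

variable {M : Type*} [TopologicalSpace M] [ChartedSpace (EuclideanSpace ℝ (Fin 2)) M]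
  {F : M → HypProd} {Φ : AmbIsometry} {I J : Set ℝ} {ψ : OpenPartialHomeomorph (ℝ × ℝ) M}
  {A B : ℝ → Fin 3 → ℝ} {φ χ : ℝ → ℝ}

namespace IsLocalForm

theorem differentiableAt_curves (L : IsLocalForm F Φ I J ψ A B φ χ) {x y : ℝ} (hx : x ∈ I)
    (hy : y ∈ J) : DifferentiableAt ℝ A y ∧ DifferentiableAt ℝ B y ∧ DifferentiableAt ℝ φ x ∧
      DifferentiableAt ℝ χ x :=
  ⟨(L.smoothA.contDiffAt (L.coord.openJ.mem_nhds hy)).differentiableAt (by simp),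
    (L.smoothB.contDiffAt (L.coord.openJ.mem_nhds hy)).differentiableAt (by simp),
    (L.smoothφ.contDiffAt (L.coord.openI.mem_nhds hx)).differentiableAt (by simp),
    (L.smoothχ.contDiffAt (L.coord.openI.mem_nhds hx)).differentiableAt (by simp)⟩

/-- The derivatives of the curves `A` and `B` are orthogonal to both curves; for the mixed products
this is where `A' ∥ B'` enters. -/
theorem lorentz_deriv (L : IsLocalForm F Φ I J ψ A B φ χ) {y : ℝ} (hy : y ∈ J) :
    lorentz (deriv A y) (A y) = 0 ∧ lorentz (deriv B y) (B y) = 0 ∧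
      lorentz (deriv A y) (B y) = 0 ∧ lorentz (deriv B y) (A y) = 0 := by
  obtain ⟨x, hx⟩ := L.coord.nonemptyI
  obtain ⟨hA, hB, -, -⟩ := L.differentiableAt_curves hx hy
  have hJ := L.coord.openJ
  have e1 := fderiv_lorentz hA hA 1
  have e2 := fderiv_lorentz hB hB 1
  have e3 := fderiv_lorentz hA hB 1
  rw [fderiv_eq_zero_of_eqOn_const hJ L.memA hy, fderiv_apply_one_eq_deriv,
    lorentz_comm (A y), zero_apply] at e1
  rw [fderiv_eq_zero_of_eqOn_const hJ (fun y hy => (L.memB y hy).1) hy, fderiv_apply_one_eq_deriv,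
    lorentz_comm (B y), zero_apply] at e2
  rw [fderiv_eq_zero_of_eqOn_const hJ L.orth hy, fderiv_apply_one_eq_deriv,
    fderiv_apply_one_eq_deriv, lorentz_comm (A y), zero_apply] at e3
  obtain ⟨a, b, hab, h⟩ := L.parallel y hy
  have hA0 := congrArg (fun X => lorentz X (A y)) h
  have hB0 := congrArg (fun X => lorentz X (B y)) h
  have e0 : ∀ X, lorentz 0 X = 0 := fun X => by simp [lorentz]
  simp only [lorentz_add_left, lorentz_smul_left, e0] at hA0 hB0
  have e1' : lorentz (deriv A y) (A y) = 0 := by linarith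
  have e2' : lorentz (deriv B y) (B y) = 0 := by linarith
  rw [e1', mul_zero, zero_add] at hA0
  rw [e2', mul_zero, add_zero] at hB0
  refine ⟨e1', e2', ?_⟩
  rcases mul_eq_zero.1 hA0 with hb | hb
  · rcases mul_eq_zero.1 hB0 with ha | ha
    · exact absurd (Prod.ext ha hb) hab
    · exact ⟨ha, by linarith⟩
  · exact ⟨by linarith, hb⟩

theorem contDiffOn_explicitForm (L : IsLocalForm F Φ I J ψ A B φ χ) :
    ContDiffOn ℝ ∞ (explicitForm A B φ χ) (I ×ˢ J) := by
  have h1 : ContDiffOn ℝ ∞ (fun z : ℝ × ℝ => φ z.1) (I ×ˢ J) :=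
    L.smoothφ.comp contDiff_fst.contDiffOn fun z hz => hz.1
  have h2 : ContDiffOn ℝ ∞ (fun z : ℝ × ℝ => χ z.1) (I ×ˢ J) :=
    L.smoothχ.comp contDiff_fst.contDiffOn fun z hz => hz.1
  have h3 : ContDiffOn ℝ ∞ (fun z : ℝ × ℝ => A z.2) (I ×ˢ J) :=
    L.smoothA.comp contDiff_snd.contDiffOn fun z hz => hz.2
  have h4 : ContDiffOn ℝ ∞ (fun z : ℝ × ℝ => B z.2) (I ×ˢ J) :=
    L.smoothB.comp contDiff_snd.contDiffOn fun z hz => hz.2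
  exact ((h1.sinh.smul h3).add (h1.cosh.smul h4)).prodMk h2

/-- The first fundamental form and the derivative of the height in the coordinates of an explicit
form. -/
theorem gram (L : IsLocalForm F Φ I J ψ A B φ χ)
    (hF : ContMDiff (𝓡 2) 𝓘(ℝ, Amb) ∞ (fun p => (F p : Amb))) :
    ∃ σ : ℝ, (σ = 1 ∨ σ = -1) ∧ ∀ x ∈ I, ∀ y ∈ J,
      let D := fderiv ℝ (fun z => (F (ψ z) : Amb)) (x, y)
      let Y := Real.sinh (φ x) • deriv A y + Real.cosh (φ x) • deriv B y
      ambMetric (D (1, 0)) (D (1, 0)) = speed φ χ x ^ 2 ∧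
      ambMetric (D (1, 0)) (D (0, 1)) = 0 ∧
      ambMetric (D (0, 1)) (D (0, 1)) = lorentz Y Y ∧
      (D (1, 0)).2 = σ * deriv χ x ∧ (D (0, 1)).2 = 0 := by
  obtain ⟨σ, c, hσ, hσc⟩ := Φ.exists_snd_eq
  refine ⟨σ, hσ, fun x hx y hy => ?_⟩
  have hIJ := L.coord.openI.prod L.coord.openJ
  have hG : ∀ z ∈ I ×ˢ J, explicitForm A B φ χ z = (Φ.toEquiv (F (ψ z)) : Amb) :=
    fun z hz => (L.form z.1 hz.1 z.2 hz.2).symm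
  have key := ambMetric_fderiv_eq hIJ (f := fun z => (F (ψ z) : Amb)) (G := explicitForm A B φ χ)
    ((L.coord.source_eq ▸ L.coord.isSmoothParam.contDiffOn_comp hF).differentiableOn (by simp))
    (L.contDiffOn_explicitForm.differentiableOn (by simp))
    (fun z hz w hw => by rw [hG z hz, hG w hw, Φ.lorentz_eq]) hσ
    (fun z hz => by rw [hG z hz, hσc]) (z := (x, y)) ⟨hx, hy⟩
  obtain ⟨hA, hB, hφ, hχ⟩ := L.differentiableAt_curves hx hy
  obtain ⟨K, hK, hK1, hK2⟩ := hasFDerivAt_explicitForm (z := (x, y)) hA hB hφ hχ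
  rw [hK.fderiv] at key
  obtain ⟨e1, e2, e3, e4⟩ := L.lorentz_deriv hy
  have hA1 : lorentz (A y) (A y) = 1 := L.memA y hy
  have hB1 : lorentz (B y) (B y) = -1 := (L.memB y hy).1
  have hAB := L.orth y hy
  have hcs := Real.cosh_sq (φ x)
  refine ⟨?_, ?_, ?_, ?_, ?_⟩
  · rw [← (key _ _).1, hK1, sq_speed]
    simp only [ambMetric, lorentz_add_left, lorentz_add_right, lorentz_smul_left,
      lorentz_smul_right, hA1, hB1, hAB, lorentz_comm (B y) (A y)]
    linear_combination deriv φ x ^ 2 * hcs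
  · rw [← (key _ _).1, hK1, hK2]
    simp only [ambMetric, lorentz_add_left, lorentz_add_right, lorentz_smul_left,
      lorentz_smul_right, lorentz_comm (A y), lorentz_comm (B y), e1, e2, e3, e4]
    ring
  · rw [← (key _ _).1, hK2]
    simp [ambMetric]
  · have h1 := (key (1, 0) (1, 0)).2
    rw [hK1] at h1
    simp only at h1
    rw [h1]
    rcases hσ with rfl | rfl <;> ring
  · have h1 := (key (0, 1) (0, 1)).2
    rw [hK2] at h1
    rcases hσ with rfl | rfl <;> simpa using h1.symm

theorem contDiffOn_deriv (L : IsLocalForm F Φ I J ψ A B φ χ) :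
    ContDiffOn ℝ ∞ (deriv φ) I ∧ ContDiffOn ℝ ∞ (deriv χ) I ∧ ContDiffOn ℝ ∞ (speed φ χ) I := by
  have h1 := ((contDiffOn_infty_iff_deriv_of_isOpen L.coord.openI).1 L.smoothφ).2
  have h2 := ((contDiffOn_infty_iff_deriv_of_isOpen L.coord.openI).1 L.smoothχ).2
  refine ⟨h1, h2, ((h1.pow 2).add (h2.pow 2)).sqrt fun x hx => ?_⟩
  have := pow_pos (speed_pos (L.regular x hx)) 2
  rw [sq_speed] at this
  exact this.ne'

/-- Reparametrization of the profile curve by arc length. -/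
theorem exists_unitSpeed (L : IsLocalForm F Φ I J ψ A B φ χ) :
    ∃ (I' : Set ℝ) (σ : ℝ → ℝ) (ψ' : OpenPartialHomeomorph (ℝ × ℝ) M),
      Set.BijOn σ I' I ∧ ContDiffOn ℝ ∞ σ I' ∧ (∀ x ∈ I', 0 < deriv σ x) ∧
      ψ'.target = ψ.target ∧ (∀ x ∈ I', ∀ y ∈ J, ψ' (x, y) = ψ (σ x, y)) ∧
      IsLocalForm F Φ I' J ψ' A B (φ ∘ σ) (χ ∘ σ) ∧ IsUnitSpeed (φ ∘ σ) (χ ∘ σ) I' := by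
  have hspos : ∀ x ∈ I, 0 < speed φ χ x := fun x hx => speed_pos (L.regular x hx)
  obtain ⟨e, heI, htgt, hes, hes', hed⟩ := exists_change_of_variable L.coord.openI
    L.coord.intervalI L.contDiffOn_deriv.2.2 hspos
  have hmap : Set.MapsTo e e.source I := fun x hx => htgt ▸ e.map_source hx
  let E := e.prod (OpenPartialHomeomorph.refl ℝ)
  have hsrc : (E.trans ψ).source = e.source ×ˢ J := by
    ext ⟨x, y⟩
    rw [OpenPartialHomeomorph.trans_source, L.coord.source_eq]
    constructor
    · rintro ⟨h1, h2⟩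
      exact ⟨h1.1, h2.2⟩
    · rintro ⟨h1, h2⟩
      exact ⟨⟨h1, trivial⟩, hmap h1, h2⟩
  have htar : (E.trans ψ).target = ψ.target := by
    rw [OpenPartialHomeomorph.trans_target]
    refine Set.inter_eq_left.2 fun p hp => ?_
    have h1 := ψ.map_target hp
    rw [L.coord.source_eq] at h1
    exact ⟨htgt ▸ h1.1, trivial⟩
  have hE : ContDiffOn ℝ ∞ E (e.source ×ˢ J) :=
    (hes.comp contDiff_fst.contDiffOn fun z hz => hz.1).prodMk contDiff_snd.contDiffOn
  have hE' : ContDiffOn ℝ ∞ E.symm (I ×ˢ J) :=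
    (hes'.comp contDiff_fst.contDiffOn fun z hz => htgt ▸ hz.1).prodMk contDiff_snd.contDiffOn
  have hdφ : ∀ x ∈ e.source, deriv (φ ∘ e) x = deriv φ (e x) * (speed φ χ (e x))⁻¹ := by
    intro x hx
    have h := (L.smoothφ.contDiffAt (L.coord.openI.mem_nhds (hmap hx))).differentiableAt (by simp)
    exact (h.hasDerivAt.comp x (hed x hx)).deriv
  have hdχ : ∀ x ∈ e.source, deriv (χ ∘ e) x = deriv χ (e x) * (speed φ χ (e x))⁻¹ := by
    intro x hx
    have h := (L.smoothχ.contDiffAt (L.coord.openI.mem_nhds (hmap hx))).differentiableAt (by simp)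
    exact (h.hasDerivAt.comp x (hed x hx)).deriv
  have hunit : IsUnitSpeed (φ ∘ e) (χ ∘ e) e.source := by
    intro x hx
    have h0 := (hspos _ (hmap hx)).ne'
    have h1 := sq_speed φ χ (e x)
    rw [speed, hdφ x hx, hdχ x hx, Real.sqrt_eq_one]
    field_simp
    linarith
  refine ⟨e.source, e, E.trans ψ, htgt ▸ e.bijOn, hes, ?_, htar, fun x hx y hy => rfl, ?_, hunit⟩
  · intro x hx
    rw [(hed x hx).deriv]
    exact inv_pos.2 (hspos _ (hmap hx))
  · refine
      { coord := ⟨e.open_source, ?_, heI, L.coord.openJ, L.coord.nonemptyJ, L.coord.intervalJ,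
          hsrc, ?_, ?_⟩
        smoothA := L.smoothA
        smoothB := L.smoothB
        smoothφ := L.smoothφ.comp hes hmap
        smoothχ := L.smoothχ.comp hes hmap
        memA := L.memA
        memB := L.memB
        orth := L.orth
        parallel := L.parallel
        regular := ?_
        form := fun x hx y hy => L.form (e x) (hmap hx) y hy }
    · obtain ⟨x, hx⟩ := L.coord.nonemptyI
      exact ⟨e.symm x, e.map_target (htgt ▸ hx)⟩
    · rw [hsrc]
      refine L.coord.smooth.comp hE.contMDiffOn fun z hz => ?_
      change E z ∈ ψ.source
      rw [L.coord.source_eq]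
      exact ⟨hmap hz.1, hz.2⟩
    · rw [htar]
      refine hE'.contMDiffOn.comp L.coord.smooth_symm fun p hp => ?_
      exact L.coord.source_eq ▸ ψ.map_target hp
    · intro x hx h
      have h1 := hunit x hx
      rw [Prod.mk.injEq] at h
      rw [speed, h.1, h.2] at h1
      norm_num at h1

/-- The sign of `φ` can be changed together with that of `A`. -/
theorem const_mul (L : IsLocalForm F Φ I J ψ A B φ χ) {ε : ℝ} (hε : ε = 1 ∨ ε = -1) :
    IsLocalForm F Φ I J ψ (fun y => ε • A y) B (fun x => ε * φ x) χ where
  coord := L.coord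
  smoothA := L.smoothA.const_smul ε
  smoothB := L.smoothB
  smoothφ := contDiffOn_const.mul L.smoothφ
  smoothχ := L.smoothχ
  memA y hy := by
    have h : lorentz (A y) (A y) = 1 := L.memA y hy
    change lorentz _ _ = 1
    rw [lorentz_smul_left, lorentz_smul_right, h]
    rcases hε with rfl | rfl <;> norm_num
  memB := L.memB
  orth y hy := by rw [lorentz_smul_left, L.orth y hy, mul_zero]
  parallel y hy := by
    obtain ⟨a, b, hab, h⟩ := L.parallel y hy
    have hA : deriv (fun y => ε • A y) y = ε • deriv A y := by
      obtain ⟨x, hx⟩ := L.coord.nonemptyI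
      exact ((L.differentiableAt_curves hx hy).1.hasDerivAt.const_smul ε).deriv
    refine ⟨ε * a, b, ?_, ?_⟩
    · contrapose! hab
      rw [Prod.mk.injEq] at hab ⊢
      rcases hε with rfl | rfl <;> simpa using hab
    · rw [hA, smul_smul, ← h]
      rcases hε with rfl | rfl <;> simp
  regular x hx h := by
    apply L.regular x hx
    rw [deriv_const_mul_field] at h
    rw [Prod.mk.injEq] at h ⊢
    rcases hε with rfl | rfl <;> simpa using h
  form x hx y hy := by
    rw [L.form x hx y hy]
    rcases hε with rfl | rfl <;> simp

end IsLocalForm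

end LocalForm

section

variable {M : Type*} [TopologicalSpace M] [ChartedSpace (EuclideanSpace ℝ (Fin 2)) M]
  [IsManifold (𝓡 2) ∞ M] {g : SurfaceMetric M} {F : M → HypProd} {ξ : M → Amb}
  {Φ : AmbIsometry} {I J : Set ℝ} {ψ : OpenPartialHomeomorph (ℝ × ℝ) M}
  {A B : ℝ → Fin 3 → ℝ} {φ χ : ℝ → ℝ}

/-! ### The angle function and the coordinates of an explicit form -/

theorem cos_angle (hF : IsIsometricImmersion g F) (hξ : IsUnitNormal F ξ) (p : M) :
    Real.cos (angle ξ p) = (ξ p).2 := by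
  have h := abs_le_of_sq_le_sq' ((normal_snd_sq_le hF hξ p).trans (one_pow 2).ge) zero_le_one
  rw [angle, ambMetric_dt, Real.cos_arccos h.1 h.2]

namespace IsLocalForm

/-- The squared angle functions of the surface and of the profile curve agree, and `T` is a
multiple of `∂_x`. -/
theorem cos_sq_mul_speed_sq (L : IsLocalForm F Φ I J ψ A B φ χ) (hF : IsIsometricImmersion g F)
    (hξ : IsUnitNormal F ξ) {x y : ℝ} (hx : x ∈ I) (hy : y ∈ J) :
    (ξ (ψ (x, y))).2 ^ 2 * speed φ χ x ^ 2 = deriv φ x ^ 2 ∧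
      ∃ a : ℝ, fieldT g F (ψ (x, y)) = a • coordX ψ (x, y) := by
  have hψ := L.coord.isSmoothParam
  have S := hF.isLocalSurface hξ hψ
  have hz : (x, y) ∈ ψ.source := by rw [L.coord.source_eq]; exact ⟨hx, hy⟩
  obtain ⟨σ, hσ, hg⟩ := L.gram hF.smooth
  obtain ⟨e1, e2, -, e4, e5⟩ := hg x hx y hy
  obtain ⟨τ, hτ⟩ := S.exists_vertical hz
  have hh := S.height_eq hz hτ
  have hlin : fderiv ℝ (fun z => (F (ψ z) : Amb)) (x, y) τ =
      τ.1 • fderiv ℝ (fun z => (F (ψ z) : Amb)) (x, y) (1, 0) +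
        τ.2 • fderiv ℝ (fun z => (F (ψ z) : Amb)) (x, y) (0, 1) := by
    rw [← map_smul, ← map_smul, ← map_add]
    congr 1
    ext <;> simp
  have hY : ambMetric (fderiv ℝ (fun z => (F (ψ z) : Amb)) (x, y) (0, 1))
      (fderiv ℝ (fun z => (F (ψ z) : Amb)) (x, y) (0, 1)) ≠ 0 := by
    intro h
    have h1 := eq_zero_of_ambMetric_self (S.mem _ hz) (S.lorentz_fderiv hz _) h
    have h2 := congrArg Prod.snd (S.injective _ hz _ h1)
    simp at h2
  have h1 := hh (0, 1)
  have h2 := hh (1, 0)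
  rw [e5, hlin, ambMetric_add_right, ambMetric_smul_right, ambMetric_smul_right,
    ambMetric_comm, e2, mul_zero, zero_add, eq_comm, mul_eq_zero, or_iff_left hY] at h1
  rw [h1, zero_smul, add_zero] at hlin
  rw [e4, hlin, ambMetric_smul_right, e1] at h2
  have h3 := congrArg Prod.snd hτ
  rw [hlin, Prod.smul_snd, e4] at h3
  simp only [dt, Prod.snd_sub, Prod.smul_snd, smul_eq_mul] at h3
  refine ⟨?_, τ.1, ?_⟩
  · have h4 := sq_speed φ χ x
    have h5 : deriv χ x ^ 2 = (1 - (ξ (ψ (x, y))).2 ^ 2) * speed φ χ x ^ 2 := by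
      have hσ2 : σ ^ 2 = 1 := by rcases hσ with rfl | rfl <;> norm_num
      linear_combination (-deriv χ x ^ 2) * hσ2 + σ * deriv χ x * h2 + speed φ χ x ^ 2 * h3
    linarith
  · have h4 : fieldT g F (ψ (x, y)) = mfderiv 𝓘(ℝ, ℝ × ℝ) (𝓡 2) ψ (x, y) τ :=
      hF.tangentPart_eq hξ hψ hz (c := (ξ (ψ (x, y))).2) (by rw [hτ]; simp)
    have h5 : τ = τ.1 • ((1, 0) : ℝ × ℝ) := by ext <;> simp [h1]
    have h6 : mfderiv 𝓘(ℝ, ℝ × ℝ) (𝓡 2) ψ (x, y) (τ.1 • ((1, 0) : ℝ × ℝ)) =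
        τ.1 • mfderiv 𝓘(ℝ, ℝ × ℝ) (𝓡 2) ψ (x, y) ((1, 0) : ℝ × ℝ) := by
      erw [map_smul]
    rw [h4]
    conv_lhs => rw [h5]
    exact h6

theorem deriv_ne_zero (L : IsLocalForm F Φ I J ψ A B φ χ) (hF : IsIsometricImmersion g F)
    (hξ : IsUnitNormal F ξ)
    (hθ : ∀ p, angle ξ p ≠ 0 ∧ angle ξ p ≠ Real.pi / 2 ∧ angle ξ p ≠ Real.pi) {x : ℝ}
    (hx : x ∈ I) : deriv φ x ≠ 0 ∧ deriv χ x ≠ 0 := by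
  obtain ⟨y, hy⟩ := L.coord.nonemptyJ
  have h1 := (L.cos_sq_mul_speed_sq hF hξ hx hy).1
  have hs := speed_pos (L.regular x hx)
  have hs2 := sq_speed φ χ x
  obtain ⟨h0, hpi2, hpi⟩ := hθ (ψ (x, y))
  have hc := normal_snd_sq_lt hF hξ h0 hpi
  have hc0 := normal_snd_ne_zero hpi2
  constructor
  · intro h
    rw [h, zero_pow two_ne_zero] at h1
    exact (mul_pos (pow_pos (abs_pos.2 hc0) 2) (pow_pos hs 2)).ne' (by rw [sq_abs]; exact h1)
  · intro h
    rw [h] at hs2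
    nlinarith [pow_pos hs 2]

/-- In an explicit form the angle function of the surface is, up to constant signs, the angle
function of the profile curve. -/
theorem exists_curveAngle (L : IsLocalForm F Φ I J ψ A B φ χ) (hF : IsIsometricImmersion g F)
    (hξ : IsUnitNormal F ξ)
    (hθ : ∀ p, angle ξ p ≠ 0 ∧ angle ξ p ≠ Real.pi / 2 ∧ angle ξ p ≠ Real.pi) :
    ∃ (ε δ : ℝ) (ϑ : ℝ → ℝ), (ε = 1 ∨ ε = -1) ∧ (δ = 1 ∨ δ = -1) ∧
      (∀ x ∈ I, ∀ y ∈ J, angle ξ (ψ (x, y)) = ϑ x) ∧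
      IsCurveAngle (fun x => ε * φ x) (fun x => δ * χ x) ϑ I := by
  obtain ⟨hφ, hχ, hs⟩ := L.contDiffOn_deriv
  have hspos : ∀ x ∈ I, 0 < speed φ χ x := fun x hx => speed_pos (L.regular x hx)
  have S := hF.isLocalSurface hξ L.coord.isSmoothParam
  have hfst : Set.MapsTo (Prod.fst : ℝ × ℝ → ℝ) (I ×ˢ J) I := fun z hz => hz.1
  obtain ⟨ε, hε, hc⟩ : ∃ ε : ℝ, (ε = 1 ∨ ε = -1) ∧ ∀ x ∈ I, ∀ y ∈ J,
      (ξ (ψ (x, y))).2 = ε * deriv φ x / speed φ χ x := by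
    have hpre : IsPreconnected (I ×ˢ J) :=
      L.coord.intervalI.isPreconnected.prod L.coord.intervalJ.isPreconnected
    have hcont : ContinuousOn (fun z : ℝ × ℝ => (ξ (ψ z)).2 * speed φ χ z.1) (I ×ˢ J) :=
      (L.coord.source_eq ▸ S.smooth_normal.snd.continuousOn).mul
        (hs.continuousOn.comp continuousOn_fst hfst)
    rcases hpre.eq_or_eq_neg_of_sq_eq hcont (hφ.continuousOn.comp continuousOn_fst hfst)
      (fun z hz => by
        have := (L.cos_sq_mul_speed_sq hF hξ hz.1 hz.2).1
        simpa [mul_pow] using this)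
      (fun hz => (L.deriv_ne_zero hF hξ hθ hz.1).1) with h | h
    · refine ⟨1, Or.inl rfl, fun x hx y hy => ?_⟩
      rw [eq_div_iff (hspos x hx).ne', one_mul]
      exact h ⟨hx, hy⟩
    · refine ⟨-1, Or.inr rfl, fun x hx y hy => ?_⟩
      rw [eq_div_iff (hspos x hx).ne', neg_one_mul]
      exact h ⟨hx, hy⟩
  obtain ⟨δ, hδ, hsign⟩ : ∃ δ : ℝ, (δ = 1 ∨ δ = -1) ∧ ∀ x ∈ I, |deriv χ x| = δ * deriv χ x := by
    rcases L.coord.intervalI.isPreconnected.eq_or_eq_neg_of_sq_eq hχ.continuousOn.abs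
      hχ.continuousOn (fun x hx => by simp) (fun hx => (L.deriv_ne_zero hF hξ hθ hx).2) with h | h
    · exact ⟨1, Or.inl rfl, fun x hx => by rw [one_mul]; exact h hx⟩
    · exact ⟨-1, Or.inr rfl, fun x hx => by rw [neg_one_mul]; exact h hx⟩
  have hε2 : ε ^ 2 = 1 := by rcases hε with rfl | rfl <;> norm_num
  have hsq : ∀ x ∈ I, 1 - (ε * deriv φ x / speed φ χ x) ^ 2 =
      (|deriv χ x| / speed φ χ x) ^ 2 := by
    intro x hx
    have h1 := sq_speed φ χ x
    have h2 := (hspos x hx).ne'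
    field_simp
    rw [sq_abs, hε2]
    linarith
  have hlt : ∀ x ∈ I, (ε * deriv φ x / speed φ χ x) ^ 2 < 1 := by
    intro x hx
    have h1 := hsq x hx
    have h2 : 0 < (|deriv χ x| / speed φ χ x) ^ 2 :=
      pow_pos (div_pos (abs_pos.2 (L.deriv_ne_zero hF hξ hθ hx).2) (hspos x hx)) 2
    linarith
  refine ⟨ε, δ, fun x => Real.arccos (ε * deriv φ x / speed φ χ x), hε, hδ, ?_, ?_, ?_⟩
  · intro x hx y hy
    rw [angle, ambMetric_dt, hc x hx y hy]
  · intro x hx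
    have h1 : ContDiffAt ℝ ∞ (fun x => ε * deriv φ x / speed φ χ x) x :=
      ((contDiffOn_const.mul hφ).div hs fun x hx => (hspos x hx).ne').contDiffAt
        (L.coord.openI.mem_nhds hx)
    have h2 := hlt x hx
    refine ((Real.contDiffAt_arccos ?_ ?_).comp x h1).contDiffWithinAt <;>
    · intro h; rw [h] at h2; norm_num at h2
  · intro x hx
    have h2 := hlt x hx
    have h3 := (abs_lt.1 ((sq_lt_one_iff_abs_lt_one _).1 h2))
    have hs0 := (hspos x hx).ne'
    rw [speed_const_mul hε hδ, deriv_const_mul_field, deriv_const_mul_field,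
      Real.cos_arccos h3.1.le h3.2.le, Real.sin_arccos, hsq x hx,
      Real.sqrt_sq (div_nonneg (abs_nonneg _) (hspos x hx).le), hsign x hx]
    constructor <;> field_simp

/-- If the profile curve is parametrized by arc length, the coordinates are canonical. -/
theorem isCanonical (L : IsLocalForm F Φ I J ψ A B φ χ) (hF : IsIsometricImmersion g F)
    (hξ : IsUnitNormal F ξ) (hu : IsUnitSpeed φ χ I) : IsCanonical g F ψ := by
  have hψ := L.coord.isSmoothParam
  have S := hF.isLocalSurface hξ hψ
  obtain ⟨σ, -, hg⟩ := L.gram hF.smooth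
  let Y : ℝ × ℝ → Fin 3 → ℝ := fun z =>
    Real.sinh (φ z.1) • deriv A z.2 + Real.cosh (φ z.1) • deriv B z.2
  have hinner : ∀ z ∈ ψ.source, ∀ v w : ℝ × ℝ,
      g.inner (ψ z) (mfderiv 𝓘(ℝ, ℝ × ℝ) (𝓡 2) ψ z v) (mfderiv 𝓘(ℝ, ℝ × ℝ) (𝓡 2) ψ z w) =
        ambMetric (fderiv ℝ (fun z => (F (ψ z) : Amb)) z v)
          (fderiv ℝ (fun z => (F (ψ z) : Amb)) z w) := by
    intro z hz v w
    rw [hF.isometric, hψ.fderiv_comp hF.smooth hz, hψ.fderiv_comp hF.smooth hz]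
    rfl
  have hYpos : ∀ z ∈ ψ.source, 0 < lorentz (Y z) (Y z) := by
    intro z hz
    have hz' := hz
    rw [L.coord.source_eq] at hz'
    have h1 := (hg z.1 hz'.1 z.2 hz'.2).2.2.1
    have h2 := hinner z hz (0, 1) (0, 1)
    rw [h1] at h2
    change 0 < lorentz (Real.sinh (φ z.1) • deriv A z.2 + Real.cosh (φ z.1) • deriv B z.2) _
    rw [← h2]
    apply g.pos
    intro h0
    have h3 := congrArg Prod.snd ((hψ.mfderiv_eq_zero_iff hz).1 h0)
    simp at h3
  have hYs : ContDiffOn ℝ ∞ (fun z => Real.sqrt (lorentz (Y z) (Y z))) ψ.source := by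
    have hA := ((contDiffOn_infty_iff_deriv_of_isOpen L.coord.openJ).1 L.smoothA).2
    have hB := ((contDiffOn_infty_iff_deriv_of_isOpen L.coord.openJ).1 L.smoothB).2
    have h1 : ContDiffOn ℝ ∞ (fun z : ℝ × ℝ => φ z.1) (I ×ˢ J) :=
      L.smoothφ.comp contDiff_fst.contDiffOn fun z hz => hz.1
    have h3 : ContDiffOn ℝ ∞ (fun z : ℝ × ℝ => deriv A z.2) (I ×ˢ J) :=
      hA.comp contDiff_snd.contDiffOn fun z hz => hz.2
    have h4 : ContDiffOn ℝ ∞ (fun z : ℝ × ℝ => deriv B z.2) (I ×ˢ J) :=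
      hB.comp contDiff_snd.contDiffOn fun z hz => hz.2
    have hY : ContDiffOn ℝ ∞ Y ψ.source := by
      rw [L.coord.source_eq]
      exact (h1.sinh.smul h3).add (h1.cosh.smul h4)
    exact (contDiffOn_lorentz hY hY).sqrt fun z hz => (hYpos z hz).ne'
  refine ⟨_, hYs, fun z hz => ⟨Real.sqrt_pos.2 (hYpos z hz), ?_⟩⟩
  have hz' := hz
  rw [L.coord.source_eq] at hz'
  obtain ⟨e1, e2, e3, -, -⟩ := hg z.1 hz'.1 z.2 hz'.2
  refine ⟨(L.cos_sq_mul_speed_sq hF hξ hz'.1 hz'.2).2, ?_, ?_, ?_⟩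
  · refine (hinner z hz (1, 0) (1, 0)).trans (e1.trans ?_)
    rw [hu _ hz'.1, one_pow]
  · exact (hinner z hz (1, 0) (0, 1)).trans e2
  · refine (hinner z hz (0, 1) (0, 1)).trans (e3.trans ?_)
    exact (Real.sq_sqrt (hYpos z hz).le).symm

/-- A surface that admits an explicit form has `T` principal, because its angle function is
constant along the curves `x = const`, the level curves of the height. -/
theorem isPrincipalDirection (L : IsLocalForm F Φ I J ψ A B φ χ) (hF : IsIsometricImmersion g F)
    (hξ : IsUnitNormal F ξ)
    (hθ : ∀ p, angle ξ p ≠ 0 ∧ angle ξ p ≠ Real.pi / 2 ∧ angle ξ p ≠ Real.pi) {p : M}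
    (hp : p ∈ ψ.target) : IsPrincipalDirection g F ξ p (fieldT g F p) := by
  have hψ := L.coord.isSmoothParam
  have S := hF.isLocalSurface hξ hψ
  obtain ⟨⟨x, y⟩, hz, rfl⟩ : ∃ z, z ∈ ψ.source ∧ ψ z = p :=
    ⟨ψ.symm p, ψ.map_target hp, ψ.right_inv hp⟩
  have hxy := hz
  rw [L.coord.source_eq] at hxy
  obtain ⟨hx, hy⟩ := hxy
  have hc := normal_snd_sq_lt hF hξ (hθ (ψ (x, y))).1 (hθ (ψ (x, y))).2.2
  rw [isPrincipalDirection_iff hF hξ hψ hz hc]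
  refine S.exists_isPrincipalAt hz hc fun v hv => ?_
  obtain ⟨-, -, ϑ, -, -, hϑ, -⟩ := L.exists_curveAngle hF hξ hθ
  obtain ⟨σ, hσ, hg⟩ := L.gram hF.smooth
  obtain ⟨-, -, -, e4, e5⟩ := hg x hx y hy
  have hv' : v = v.1 • ((1, 0) : ℝ × ℝ) + v.2 • ((0, 1) : ℝ × ℝ) := by ext <;> simp
  have hv1 : v.1 = 0 := by
    rw [hv', map_add, map_smul, map_smul, Prod.snd_add, Prod.smul_snd, Prod.smul_snd, e4, e5,
      smul_zero, add_zero, smul_eq_mul] at hv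
    have hχ := (L.deriv_ne_zero hF hξ hθ hx).2
    refine (mul_eq_zero.1 hv).resolve_right (mul_ne_zero ?_ hχ)
    rcases hσ with rfl | rfl <;> norm_num
  have hconst : (fderiv ℝ (fun z => ξ (ψ z)) (x, y) (0, 1)).2 = 0 := by
    have h1 := (S.differentiableAt_normal hz).hasFDerivAt.snd
    have h2 : HasDerivAt (fun t : ℝ => (x, t)) ((0, 1) : ℝ × ℝ) y :=
      (hasDerivAt_const y x).prodMk (hasDerivAt_id y)
    have h3 := (h1.comp_hasDerivAt y h2).deriv
    have h4 : ((fun z => (ξ (ψ z)).2) ∘ fun t : ℝ => (x, t)) =ᶠ[nhds y]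
        fun _ => Real.cos (ϑ x) := by
      filter_upwards [L.coord.openJ.mem_nhds hy] with t ht
      rw [← hϑ x hx t ht, cos_angle hF hξ]
      rfl
    rw [h4.deriv_eq, deriv_const] at h3
    exact h3.symm
  rw [hv', hv1, zero_smul, zero_add, map_smul, Prod.smul_snd, hconst, smul_zero]

end IsLocalForm

/-- If `T` is principal everywhere, the surface has, around every point and without moving it by an
isometry, an explicit form whose second profile coordinate is the parameter. -/
theorem exists_isLocalForm (hF : IsIsometricImmersion g F) (hξ : IsUnitNormal F ξ)
    (hθ : ∀ p, angle ξ p ≠ 0 ∧ angle ξ p ≠ Real.pi / 2 ∧ angle ξ p ≠ Real.pi)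
    (hP : ∀ p, IsPrincipalDirection g F ξ p (fieldT g F p)) (p : M) :
    ∃ (I J : Set ℝ) (ψ : OpenPartialHomeomorph (ℝ × ℝ) M) (A B : ℝ → Fin 3 → ℝ) (φ : ℝ → ℝ),
      IsLocalForm F AmbIsometry.refl I J ψ A B φ id ∧ p ∈ ψ.target := by
  obtain ⟨ψ, hψ, hp⟩ := exists_isSmoothParam p
  have S := hF.isLocalSurface hξ hψ
  have hc : ∀ z ∈ ψ.source, (ξ (ψ z)).2 ^ 2 < 1 := fun z _ =>
    normal_snd_sq_lt hF hξ (hθ (ψ z)).1 (hθ (ψ z)).2.2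
  obtain ⟨e, I, J, A, B, φ, hI, hJ, hI', hJ', hsrc, htgt, hze, hes, hes', hA, hB, hφ, hAB, hf⟩ :=
    S.exists_form hc (fun z hz => (isPrincipalDirection_iff hF hξ hψ hz (hc z hz)).1 (hP _))
      (ψ.map_target hp)
  have hmaps : Set.MapsTo e e.source ψ.source := fun z hz => htgt (e.map_source hz)
  have hsrc' : (e.trans ψ).source = I ×ˢ J := by
    rw [OpenPartialHomeomorph.trans_source, ← hsrc]
    exact Set.inter_eq_left.2 hmaps
  have htgt' : ∀ q ∈ (e.trans ψ).target, q ∈ ψ.target ∧ ψ.symm q ∈ e.target := by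
    intro q hq
    rwa [OpenPartialHomeomorph.trans_target] at hq
  have hpt : p ∈ (e.trans ψ).target := by
    rw [OpenPartialHomeomorph.trans_target]
    exact ⟨hp, hze⟩
  have hne : (I ×ˢ J).Nonempty := ⟨_, hsrc ▸ e.map_target hze⟩
  refine ⟨I, J, e.trans ψ, A, B, φ, ?_, hpt⟩
  exact
    { coord := ⟨hI, hne.fst, hI', hJ, hne.snd, hJ', hsrc',
        by
          rw [hsrc', ← hsrc]
          exact hψ.smooth.comp hes.contMDiffOn hmaps,
        hes'.contMDiffOn.comp (hψ.smooth_symm.mono fun q hq => (htgt' q hq).1)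
          fun q hq => (htgt' q hq).2⟩
      smoothA := hA
      smoothB := hB
      smoothφ := hφ
      smoothχ := contDiffOn_id
      memA := fun y hy => (hAB y hy).1
      memB := fun y hy => (hAB y hy).2.1
      orth := fun y hy => (hAB y hy).2.2.1
      parallel := fun y hy => (hAB y hy).2.2.2
      regular := fun x hx h => by
        rw [Prod.mk.injEq, deriv_id] at h
        exact one_ne_zero h.2
      form := fun x hx y hy => hf x hx y hy }

end

end H2R

theorem theorem4 {M : Type*} [TopologicalSpace M] [ChartedSpace (EuclideanSpace ℝ (Fin 2)) M]
    [IsManifold (𝓡 2) ∞ M] (g : SurfaceMetric M) (F : M → HypProd) (ξ : M → Amb)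
    (hF : IsIsometricImmersion g F) (hξ : IsUnitNormal F ξ)
    (hθ : ∀ p, angle ξ p ≠ 0 ∧ angle ξ p ≠ Real.pi / 2 ∧ angle ξ p ≠ Real.pi) :
    -- `T` is a principal direction if and only if `F` has, locally and up to ambient
    -- isometries, the explicit form
    ((∀ p, IsPrincipalDirection g F ξ p (fieldT g F p)) ↔
      ∀ p, ∃ (Φ : AmbIsometry) (I J : Set ℝ) (ψ : OpenPartialHomeomorph (ℝ × ℝ) M)
        (A B : ℝ → Fin 3 → ℝ) (φ χ : ℝ → ℝ),
        IsLocalForm F Φ I J ψ A B φ χ ∧ p ∈ ψ.target) ∧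
    -- in every such local form: up to the signs of the two coordinates of the plane curve,
    -- `θ` depends only on `x` and is the angle function of `(φ, χ)`; if the curve is parametrized
    -- by arc length, then the coordinates are canonical and `θ' = κ`;
    -- moreover the curve can be reparametrized by arc length
    (∀ (Φ : AmbIsometry) (I J : Set ℝ) (ψ : OpenPartialHomeomorph (ℝ × ℝ) M)
        (A B : ℝ → Fin 3 → ℝ) (φ χ : ℝ → ℝ), IsLocalForm F Φ I J ψ A B φ χ →
      (∃ (ε δ : ℝ) (ϑ : ℝ → ℝ), (ε = 1 ∨ ε = -1) ∧ (δ = 1 ∨ δ = -1) ∧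
        (∀ x ∈ I, ∀ y ∈ J, angle ξ (ψ (x, y)) = ϑ x) ∧
        IsCurveAngle (fun x => ε * φ x) (fun x => δ * χ x) ϑ I ∧
        (IsUnitSpeed φ χ I → IsCanonical g F ψ ∧
          ∀ x ∈ I, deriv ϑ x = curvature (fun x => ε * φ x) (fun x => δ * χ x) x)) ∧
      (∃ (I' : Set ℝ) (σ : ℝ → ℝ) (ψ' : OpenPartialHomeomorph (ℝ × ℝ) M),
        Set.BijOn σ I' I ∧ ContDiffOn ℝ ∞ σ I' ∧ (∀ x ∈ I', 0 < deriv σ x) ∧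
        ψ'.target = ψ.target ∧ (∀ x ∈ I', ∀ y ∈ J, ψ' (x, y) = ψ (σ x, y)) ∧
        IsLocalForm F Φ I' J ψ' A B (φ ∘ σ) (χ ∘ σ) ∧ IsUnitSpeed (φ ∘ σ) (χ ∘ σ) I')) ∧
    -- if `T` is a principal direction, the local forms can be chosen with an arc length
    -- parametrized `(φ, χ)` whose angle function is exactly `θ`, so that the coordinates are
    -- canonical and `θ' = κ`
    ((∀ p, IsPrincipalDirection g F ξ p (fieldT g F p)) →
      ∀ p, ∃ (Φ : AmbIsometry) (I J : Set ℝ) (ψ : OpenPartialHomeomorph (ℝ × ℝ) M)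
        (A B : ℝ → Fin 3 → ℝ) (φ χ ϑ : ℝ → ℝ),
        IsLocalForm F Φ I J ψ A B φ χ ∧ p ∈ ψ.target ∧
        (∀ x ∈ I, ∀ y ∈ J, angle ξ (ψ (x, y)) = ϑ x) ∧ IsCurveAngle φ χ ϑ I ∧
        IsUnitSpeed φ χ I ∧ IsCanonical g F ψ ∧ ∀ x ∈ I, deriv ϑ x = curvature φ χ x) := by
  refine ⟨⟨fun hP p => ?_, fun h p => ?_⟩, ?_, fun hP p => ?_⟩
  · obtain ⟨I, J, ψ, A, B, φ, L, hp⟩ := exists_isLocalForm hF hξ hθ hP p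
    exact ⟨_, I, J, ψ, A, B, φ, id, L, hp⟩
  · obtain ⟨Φ, I, J, ψ, A, B, φ, χ, L, hp⟩ := h p
    exact L.isPrincipalDirection hF hξ hθ hp
  · intro Φ I J ψ A B φ χ L
    refine ⟨?_, L.exists_unitSpeed⟩
    obtain ⟨ε, δ, ϑ, hε, hδ, hϑ, hcurve⟩ := L.exists_curveAngle hF hξ hθ
    refine ⟨ε, δ, ϑ, hε, hδ, hϑ, hcurve, fun hu => ⟨L.isCanonical hF hξ hu, fun x hx => ?_⟩⟩
    exact hcurve.deriv_eq_curvature L.coord.openI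
      (fun x hx => (speed_const_mul hε hδ φ χ x).trans (hu x hx)) hx
  · obtain ⟨I, J, ψ, A, B, φ, L, hp⟩ := exists_isLocalForm hF hξ hθ hP p
    obtain ⟨I', σ, ψ', -, -, hσ, htgt, -, L', hu⟩ := L.exists_unitSpeed
    obtain ⟨ε, δ, ϑ, hε, hδ, hϑ, hcurve⟩ := L'.exists_curveAngle hF hξ hθ
    -- the height increases with `x` and `sin θ ≥ 0`, hence `δ = 1`
    have hδ1 : δ = 1 := by
      refine hδ.resolve_right fun hδ' => ?_
      obtain ⟨x, hx⟩ := L'.coord.nonemptyI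
      obtain ⟨y, hy⟩ := L'.coord.nonemptyJ
      have h1 := (hcurve.2 x hx).2
      have h2 : 0 ≤ Real.sin (ϑ x) := by
        rw [← hϑ x hx y hy]
        exact Real.sin_nonneg_of_nonneg_of_le_pi (Real.arccos_nonneg _) (Real.arccos_le_pi _)
      rw [speed_const_mul hε hδ, hu x hx, deriv_const_mul_field, hδ', one_mul] at h1
      have h3 : 0 < deriv (id ∘ σ) x := hσ x hx
      linarith
    have L'' := L'.const_mul hε
    have hcurve' : IsCurveAngle (fun x => ε * (φ ∘ σ) x) (id ∘ σ) ϑ I' := by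
      simpa only [hδ1, one_mul] using hcurve
    have hu' : IsUnitSpeed (fun x => ε * (φ ∘ σ) x) (id ∘ σ) I' := by
      intro x hx
      have h1 := speed_const_mul hε (Or.inl rfl) (φ ∘ σ) (id ∘ σ) x
      simp only [one_mul] at h1
      exact h1.trans (hu x hx)
    exact ⟨_, I', J, ψ', _, B, _, id ∘ σ, ϑ, L'', htgt ▸ hp, hϑ, hcurve', hu',
      L''.isCanonical hF hξ hu', fun x hx => hcurve'.deriv_eq_curvature L''.coord.openI hu' hx⟩
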